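/- **Setting.** Let $\mathbf k$ be a differential field of characteristic $0$ with one derivation $\delta$, and let $\mathbf k\{Y\}=\mathbf k[y^{(j)} : y\in Y,\ j\ge 0]$ be the ring of ordinary differential polynomials in the finite set of indeterminates $Y=\{y_1,\dots,y_n\}$, with $\delta y^{(j)}=y^{(j+1)}$. Fix a ranking, i.e. a total order on the derivatives $y^{(j)}$ such that $\delta^l u\ge u$ and $u\ge v\Rightarrow\delta^l u\ge\delta^l v$ for all $l\ge 0$. For $f\notin\mathbf k$, the leader $\operatorname{ld}f=y_i^{(e)}$ is the highest derivative in $f$, $\operatorname{lv}f=y_i$ is its leading indeterminate, and $\operatorname{rk}f=(\operatorname{ld}f)^q$ with $q=\deg_{\operatorname{ld}f}f$ is its rank; ranks are compared by leader, then by degree. (Elements of $\mathbf k$ have no rank; their rank counts as different from that of any $f\notin\mathbf k$.) The initial $\mathbf i_f$ is the coefficient of $(\operatorname{ld}f)^q$ in $f$, and the separant is $\mathbf s_f=\partial f/\partial \operatorname{ld}f$. A polynomial $f$ is algebraically reduced w.r.t. $g$ if $\deg_{\operatorname{ld}g}f<\deg_{\operatorname{ld}g}g$, and reduced w.r.t.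 $g$ if moreover no proper derivative of $\operatorname{ld}g$ occurs in $f$. For a set $F$, $[F]$ is the differential ideal generated by $F$, $H_F$ is the set of initials and separants of the elements of $F$, $S^\infty$ is the multiplicative set containing $1$ generated by $S$, $A:S^\infty=\{a\mid \exists s\in S^\infty,\ sa\in A\}$, and $m_i(F)$ is the maximal order of $y_i$ in $F$ ($0$ if $y_i$ does not occur). A set of elements of $\mathbf k\{Y\}\setminus\mathbf k$ is weak d-triangular if the leading indeterminates of its elements are pairwise distinct, and triangular if their leaders are. For a triangular set $\mathbb B$, let $\mathbb B^0$ (resp. $\mathbb B^*$) consist of the elements of lowest (resp. highest) rank among the elements of $\mathbb B$ with the same leading indeterminate. The algebraic remainder $\mathsf{algrem}(f,S)$ is obtained from $f$ by successive pseudo-divisions by elements $p\in S$ (as univariate polynomials in $\operatorname{ld}p$) w.r.t. which the current polynomial is not algebraically reduced, in any order, until it is algebraically reduced w.r.t. all elements of $S$. Here a pseudo-division of $f$ by $p$ replaces $f$ by some $g$ with $\mathbf i_p^e f=qp+g$ for some $e\ge 0$ and $q\in\mathbf k\{Y\}$, and $\deg_{\operatorname{ld}p}g<\deg_{\operatorname{ld}p}p$.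 **Algorithm Differentiate&Autoreduce.** Input: a weak d-triangular set $\mathbb C=\{C_1,\dots,C_k\}$ with $\operatorname{ld}C_i=y_i^{(d_i)}$ (after renumbering the indeterminates), and non-negative integers $m_1,\dots,m_k$ with $m_i\ge m_i(\mathbb C)$. For a set $F$ let $F_{\{m_i\}}$ be the set of $f\in F$ such that, if $\operatorname{ld}f=y_i^{(e)}$ with $1\le i\le k$, then $e\le m_i$. Start with $\mathbb D:=\mathbb C$, $\mathbb B:=\varnothing$. While $\mathbb D\cup(\delta\mathbb B^*)_{\{m_i\}}\ne\varnothing$: let $f$ be its element of least rank; if $f\in\mathbb D$, put $\bar f:=\mathsf{algrem}(f,\mathbb B)$ and remove $f$ from $\mathbb D$; otherwise put $\bar f:=\mathsf{algrem}(f,\mathbb B\cup(\delta\mathbb B^0\setminus\{f\}))$; if $\operatorname{rk}\bar f\ne\operatorname{rk}f$, return $\{1\}$; otherwise replace $\mathbb B$ by $\mathbb B\cup\{\bar f\}$. At the end of the loop return $\mathbb B$. **Proposition.** Algorithm Differentiate&Autoreduce terminates and is correct. That is, whatever the order of the pseudo-divisions, every computation of an algebraic remainder terminates, the loop runs at most $\sum_{i=1}^k(m_i-d_i+1)$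 times, every computation ends with an output, and every output is either a triangular set $$\mathbb B=\{B_i^j\mid 1\le i\le k,\ 0\le j\le m_i-d_i\}$$ such that - $\operatorname{rk}B_i^j=\operatorname{rk}\delta^jC_i$, and $B_i^j$ is reduced w.r.t. every element of $\mathbb C\setminus\{C_i\}$; - $m_i(\mathbb B)\le m_i$ for $1\le i\le k$, and $m_i(\mathbb B)\le m_i(\mathbb C)+\sum_{j=1}^k(m_j-d_j)$ for $k<i\le n$; - $\mathbb B\subset[\mathbb B^0]\subset[\mathbb C]\subset[\mathbb B]:H_{\mathbb B}^\infty$; - $H_{\mathbb B}\subset H_{\mathbb C}^\infty+[\mathbb C]$ and $H_{\mathbb C}\subset(H_{\mathbb B}^\infty+[\mathbb B]):H_{\mathbb B}^\infty$; or $\{1\}$, and then $[\mathbb C]:H_{\mathbb C}^\infty=(1)$. -/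

import Mathlib

open scoped Pointwise Differential

namespace DiffAlg

/-- The derivative `y^(j)` of a differential indeterminate `y ∈ Y` (ordinary case). -/
@[ext]
structure Deriv (Y : Type*) where
  var : Y
  ord : ℕ

/-- The action of `δ^k` on derivatives. -/
def Deriv.shift {Y : Type*} (k : ℕ) (u : Deriv Y) : Deriv Y := ⟨u.var, u.ord + k⟩

/-- A total order on the derivatives is a ranking. -/
structure IsRanking (Y : Type*) [LinearOrder (Deriv Y)] : Prop where
  le_shift : ∀ (k : ℕ) (u : Deriv Y), u ≤ u.shift k
  shift_le_shift : ∀ (k : ℕ) (u v : Deriv Y), v ≤ u → v.shift k ≤ u.shift k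

noncomputable section

open MvPolynomial

/-- The ring `K{Y}` of ordinary differential polynomials. -/
abbrev DiffPoly (Y K : Type*) [Field K] := MvPolynomial (Deriv Y) K

section derivation

variable {Y K : Type*} [Field K] [Differential K]

/-- Apply the derivation of `K` to all coefficients. -/
def coeffDeriv (p : DiffPoly Y K) : DiffPoly Y K :=
  ∑ s ∈ p.support, monomial s (p.coeff s)′

theorem coeff_coeffDeriv (p : DiffPoly Y K) (t : Deriv Y →₀ ℕ) :
    (coeffDeriv p).coeff t = (p.coeff t)′ := by
  classical
  rw [coeffDeriv, coeff_sum]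
  simp only [coeff_monomial]
  rw [Finset.sum_ite_eq']
  split_ifs with h
  · rfl
  · rw [notMem_support_iff.mp h, map_zero]

theorem coeffDeriv_add (p q : DiffPoly Y K) :
    coeffDeriv (p + q) = coeffDeriv p + coeffDeriv q := by
  ext t
  simp [coeff_coeffDeriv]

theorem coeffDeriv_mul (p q : DiffPoly Y K) :
    coeffDeriv (p * q) = p * coeffDeriv q + q * coeffDeriv p := by
  classical
  ext t
  rw [coeff_coeffDeriv, mul_comm q, coeff_add, coeff_mul, coeff_mul, coeff_mul, map_sum,
    ← Finset.sum_add_distrib]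
  refine Finset.sum_congr rfl fun x _ => ?_
  rw [Derivation.leibniz, coeff_coeffDeriv, coeff_coeffDeriv, smul_eq_mul, smul_eq_mul]
  ring

/-- The derivation `δ` of `K{Y}`: it extends the derivation of `K` and sends `y^(j)` to
`y^(j+1)`. -/
def δ : Derivation ℤ (DiffPoly Y K) (DiffPoly Y K) :=
  Derivation.mk'
    ((AddMonoidHom.mk' (fun p : DiffPoly Y K =>
        coeffDeriv p + mkDerivation K (fun u : Deriv Y => (X (u.shift 1) : DiffPoly Y K)) p)
      (fun p q => by rw [coeffDeriv_add, map_add]; ring)).toIntLinearMap)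
    (fun p q => by
      simp only [AddMonoidHom.coe_toIntLinearMap, AddMonoidHom.mk'_apply, coeffDeriv_mul,
        Derivation.leibniz, smul_eq_mul]
      ring)

/-- The differential ideal `[F]` generated by `F`. -/
def diffIdeal (F : Set (DiffPoly Y K)) : Ideal (DiffPoly Y K) :=
  sInf {I | F ⊆ I ∧ ∀ f ∈ I, δ f ∈ I}

end derivation

section ranks

variable {Y K : Type*} [Field K] [LinearOrder (Deriv Y)]

/-- The leader of `f`; it is `⊥` exactly for `f ∈ K`. -/
def ld (f : DiffPoly Y K) : WithBot (Deriv Y) := f.vars.max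

/-- The leading indeterminate of `f`. -/
def lv (f : DiffPoly Y K) : WithBot Y := (ld f).map Deriv.var

/-- The rank `u^d` of `f`, encoded as the pair `(u, d)`. Pairs are ordered lexicographically, and
elements of `K` have rank `⊥`. -/
def rk (f : DiffPoly Y K) : WithBot (Deriv Y ×ₗ ℕ) :=
  (ld f).map fun u => toLex (u, f.degreeOf u)

/-- The coefficient of `u^d` in `f`, for `f` regarded as a univariate polynomial in `u`. -/
def coeffIn (u : Deriv Y) (d : ℕ) (f : DiffPoly Y K) : DiffPoly Y K :=
  ∑ s ∈ f.support with s u = d, monomial (s.erase u) (f.coeff s)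

/-- The initial of `f ∉ K`. -/
def initial (f : DiffPoly Y K) : DiffPoly Y K :=
  WithBot.recBotCoe f (fun u => coeffIn u (f.degreeOf u) f) (ld f)

/-- The separant of `f ∉ K`. -/
def separant (f : DiffPoly Y K) : DiffPoly Y K :=
  WithBot.recBotCoe 0 (fun u => pderiv u f) (ld f)

/-- The set `H_F` of initials and separants of elements of `F`. -/
def initSep (F : Set (DiffPoly Y K)) : Set (DiffPoly Y K) := initial '' F ∪ separant '' F

/-- `S^∞`: the multiplicative set containing `1` and generated by `S`. -/
def powers (S : Set (DiffPoly Y K)) : Set (DiffPoly Y K) := Submonoid.closure S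

/-- `A : S^∞ = {a | ∃ s ∈ S^∞, s a ∈ A}`. -/
def saturation (A S : Set (DiffPoly Y K)) : Set (DiffPoly Y K) :=
  {a | ∃ s ∈ powers S, s * a ∈ A}

/-- `f` is partially reduced w.r.t. `g`. -/
def PartiallyReduced (f g : DiffPoly Y K) : Prop :=
  ∀ u : Deriv Y, ld g = u → ∀ k : ℕ, 1 ≤ k → u.shift k ∉ f.vars

/-- `f` is algebraically reduced w.r.t. `g`. -/
def AlgReduced (f g : DiffPoly Y K) : Prop :=
  ∀ u : Deriv Y, ld g = u → f.degreeOf u < g.degreeOf u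

/-- `f` is reduced w.r.t. `g`. -/
def Reduced (f g : DiffPoly Y K) : Prop := PartiallyReduced f g ∧ AlgReduced f g

/-- Weak d-triangular sets, in the ordinary case: no element is in `K` and the leading
indeterminates are pairwise distinct. -/
def WeakDTriangular (F : Set (DiffPoly Y K)) : Prop :=
  (∀ f ∈ F, ld f ≠ ⊥) ∧ Set.InjOn lv F

/-- Triangular sets: no element is in `K` and the leaders are pairwise distinct. -/
def Triangular (F : Set (DiffPoly Y K)) : Prop :=
  (∀ f ∈ F, ld f ≠ ⊥) ∧ Set.InjOn ld F

/-- The maximal order of the indeterminate `y` in the (finite) set `F`; it is `0` if `y` does not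
occur in `F`. -/
def maxOrd (y : Y) (F : Set (DiffPoly Y K)) : ℕ :=
  sSup {j | ∃ f ∈ F, (⟨y, j⟩ : Deriv Y) ∈ f.vars}

/-- `B⁰`: the elements of least rank among those with the same leading indeterminate. -/
def lowest (B : Set (DiffPoly Y K)) : Set (DiffPoly Y K) :=
  {f ∈ B | ∀ g ∈ B, lv g = lv f → rk f ≤ rk g}

/-- `B^*`: the elements of greatest rank among those with the same leading indeterminate. -/
def highest (B : Set (DiffPoly Y K)) : Set (DiffPoly Y K) :=
  {f ∈ B | ∀ g ∈ B, lv g = lv f → rk g ≤ rk f}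

/-! ### Algebraic pseudo-remainders -/

/-- `g` is a pseudo-remainder of `f` by some `p ∈ S` with respect to which `f` is not algebraically
reduced, for `f` and `p` regarded as univariate polynomials in the leader of `p`. -/
def PseudoDivision (S : Set (DiffPoly Y K)) (f g : DiffPoly Y K) : Prop :=
  ∃ p ∈ S, ∃ u : Deriv Y, ld p = u ∧ p.degreeOf u ≤ f.degreeOf u ∧ g.degreeOf u < p.degreeOf u ∧
    ∃ (e : ℕ) (q : DiffPoly Y K), initial p ^ e * f = q * p + g

/-- `g` is a value of `algrem(f, S)`: it results from `f` by successive pseudo-divisions by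
elements of `S`, in any order, and is algebraically reduced w.r.t. all elements of `S`. -/
def AlgRem (S : Set (DiffPoly Y K)) (f g : DiffPoly Y K) : Prop :=
  Relation.ReflTransGen (PseudoDivision S) f g ∧ ∀ p ∈ S, AlgReduced g p

/-- The computation of `algrem(f, S)` terminates: there is no infinite sequence of successive
pseudo-divisions that starts at `f`. -/
def AlgRemTerminates (S : Set (DiffPoly Y K)) (f : DiffPoly Y K) : Prop :=
  ∀ g : ℕ → DiffPoly Y K, g 0 = f → ∃ j, ¬ PseudoDivision S (g j) (g (j + 1))

end ranks

/-! ### The algorithm Differentiate&Autoreduce -/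

section algorithm

variable {Y K : Type*} [Field K] [Differential K] [LinearOrder (Deriv Y)]

/-- `F_{m_i}`: the elements of `F` with leader `y_i^(e)`, `e ≤ m_i`, if their leading indeterminate
is one of the `y_i`. -/
def bounded {k : ℕ} (y : Fin k → Y) (m : Fin k → ℕ) (F : Set (DiffPoly Y K)) :
    Set (DiffPoly Y K) :=
  {f ∈ F | ∀ (i : Fin k) (e : ℕ), ld f = (⟨y i, e⟩ : Deriv Y) → e ≤ m i}

/-- The set `D ∪ (δ B^*)_{m_i}`. -/
def candidates {k : ℕ} (y : Fin k → Y) (m : Fin k → ℕ) (D B : Set (DiffPoly Y K)) :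
    Set (DiffPoly Y K) :=
  D ∪ bounded y m (δ '' highest B)

/-- `f` is an element of least rank of `F`. -/
def IsMinRank (F : Set (DiffPoly Y K)) (f : DiffPoly Y K) : Prop :=
  f ∈ F ∧ ∀ g ∈ F, rk f ≤ rk g

open Classical in
/-- The set w.r.t. which the chosen `f` is reduced: `B` if `f ∈ D`, and `B ∪ (δ B⁰ ∖ {f})`
otherwise. -/
def reducers (D B : Set (DiffPoly Y K)) (f : DiffPoly Y K) : Set (DiffPoly Y K) :=
  if f ∈ D then B else B ∪ ((δ '' lowest B) \ {f})

/-- States of a computation: in the loop, with the current values of `D` and `B`, or halted inside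
the loop, with an output. -/
inductive State (Y K : Type*) [Field K] where
  | loop (D B : Set (DiffPoly Y K)) : State Y K
  | halted (out : Set (DiffPoly Y K)) : State Y K

/-- One iteration of the loop. For `f ∉ D` the set `D ∖ {f}` is `D`. -/
inductive Iteration {k : ℕ} (y : Fin k → Y) (m : Fin k → ℕ) : State Y K → State Y K → Prop
  | update (D B : Set (DiffPoly Y K)) (f g : DiffPoly Y K)
      (hmin : IsMinRank (candidates y m D B) f) (hrem : AlgRem (reducers D B f) f g)
      (hrk : rk g = rk f) : Iteration y m (.loop D B) (.loop (D \ {f}) (B ∪ {g}))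
  | abort (D B : Set (DiffPoly Y K)) (f g : DiffPoly Y K)
      (hmin : IsMinRank (candidates y m D B) f) (hrem : AlgRem (reducers D B f) f g)
      (hrk : rk g ≠ rk f) : Iteration y m (.loop D B) (.halted {1})

/-- In the given state the algorithm stops with output `out`. -/
inductive Returns {k : ℕ} (y : Fin k → Y) (m : Fin k → ℕ) : State Y K → Set (DiffPoly Y K) → Prop
  | exit (D B : Set (DiffPoly Y K)) (h : candidates y m D B = ∅) : Returns y m (.loop D B) B
  | halted (out : Set (DiffPoly Y K)) : Returns y m (.halted out) out

/-- The state is reached by a computation with input `C`. -/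
def Reachable {k : ℕ} (y : Fin k → Y) (m : Fin k → ℕ) (C : Set (DiffPoly Y K)) (s : State Y K) :
    Prop :=
  Relation.ReflTransGen (Iteration y m) (.loop C ∅) s

end algorithm

end

end DiffAlg

/-!
Write `B_i^j` for the element with leader `y_i^(d_i + j)`, and `u` for the leader of the candidate.
Candidates are treated in the order of their ranks. Whatever could still have to be eliminated from
the candidate lies below `u`, and hence is the leader of an element of `B`, or of `δ B⁰`; so the
remainder is reduced w.r.t. the other elements of `C`.

No divisor has the leader `u`, and divisors with higher leaders never apply, so only divisors free
of `u` are used. Modulo these divisors, the remainder is the candidate times a product `h` of their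
initials. Since `h` and the divisors are free of `u`, the same `h` relates the coefficients w.r.t.
`u` and the derivatives `∂/∂u`. If the rank is preserved, this relates the initials and the
separants, and `δ f` has the separant of `f` as its initial and its separant; thus `H_B` stays in
`H_C^∞ + [C]`, and conversely the elements of `C` and of `H_C` are recovered from `B` up to
multiplication by elements of `H_B^∞`. If the rank drops, then `h` times the initial of the
candidate lies in `[C]`, whence `0 ∈ H_C^∞ + [C]`.

An algebraic remainder terminates because each pseudo-division lowers the degree in the leader of
the divisor and does not raise the degrees in higher derivatives, so that the degrees in the
finitely many leaders of divisors decrease lexicographically.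
-/

namespace DiffAlg

noncomputable section

open MvPolynomial

section partialDerivatives

variable {σ R : Type*} [CommSemiring R]

theorem vars_pderiv_subset (u : σ) (f : MvPolynomial σ R) : (pderiv u f).vars ⊆ f.vars := by
  intro v hv
  obtain ⟨s, hs, hvs⟩ := (mem_vars_iff_mem_support _).mp hv
  rw [mem_support_iff, coeff_pderiv] at hs
  refine (mem_vars_iff_mem_support _).mpr ⟨s + Finsupp.single u 1,
    mem_support_iff.mpr (left_ne_zero_of_mul hs), ?_⟩
  rw [Finsupp.mem_support_iff] at hvs ⊢
  rw [Finsupp.add_apply]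
  omega

theorem vars_pderiv_mul_X_subset [Nontrivial R] [DecidableEq σ] (u v : σ)
    (f : MvPolynomial σ R) : (pderiv u f * X v).vars ⊆ f.vars ∪ {v} := by
  refine (vars_mul _ _).trans (Finset.union_subset_union (vars_pderiv_subset u f) ?_)
  rw [vars_X]

theorem pderiv_ne_zero [NoZeroDivisors R] [CharZero R] {u : σ} {f : MvPolynomial σ R}
    (h : u ∈ f.vars) : pderiv u f ≠ 0 := by
  obtain ⟨s, hs, hus⟩ := (mem_vars_iff_mem_support _).mp h
  have hs' : s - Finsupp.single u 1 + Finsupp.single u 1 = s :=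
    tsub_add_cancel_of_le
      (Finsupp.single_le_iff.mpr (Nat.one_le_iff_ne_zero.mpr (Finsupp.mem_support_iff.mp hus)))
  refine ne_zero_iff.mpr ⟨s - Finsupp.single u 1, ?_⟩
  rw [coeff_pderiv, hs']
  exact mul_ne_zero (mem_support_iff.mp hs) (Nat.cast_add_one_ne_zero _)

theorem notMem_vars_of_mem_closure {u : σ} {S : Set (MvPolynomial σ R)}
    (hS : ∀ p ∈ S, u ∉ p.vars) {a : MvPolynomial σ R} (ha : a ∈ Submonoid.closure S) :
    u ∉ a.vars := by
  have hle : Submonoid.closure S ≤ (supported R {v | v ≠ u}).toSubmonoid :=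
    Submonoid.closure_le.mpr fun p hp =>
      mem_supported.mpr fun v hv hvu => hS p hp (hvu ▸ hv)
  exact fun hu => mem_supported.mp (hle ha) hu rfl

end partialDerivatives

section univariate

variable {Y K : Type*} [Field K]

open Classical in
/-- A differential polynomial, regarded as a univariate polynomial in the derivative `u`. The
coefficients stay in `K{Y}`, although they do not involve `u`. -/
def toUniv (u : Deriv Y) : DiffPoly Y K →ₐ[K] Polynomial (DiffPoly Y K) :=
  aeval fun v => if v = u then Polynomial.X else Polynomial.C (X v)

theorem toUniv_X_self (u : Deriv Y) : toUniv u (X u : DiffPoly Y K) = Polynomial.X := by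
  simp [toUniv]

theorem toUniv_of_notMem_vars {u : Deriv Y} {p : DiffPoly Y K} (h : u ∉ p.vars) :
    toUniv u p = Polynomial.C p := by
  have hp : p ∈ supported K {v | v ≠ u} :=
    mem_supported.mpr fun v hv hvu => h (hvu ▸ hv)
  have hle : supported K {v | v ≠ u} ≤ AlgHom.equalizer (toUniv u) Polynomial.CAlgHom :=
    Algebra.adjoin_le <| by
      rintro _ ⟨v, hv : v ≠ u, rfl⟩
      simp [toUniv, hv]
  exact hle hp

theorem toUniv_monomial (u : Deriv Y) (s : Deriv Y →₀ ℕ) (a : K) :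
    toUniv u (monomial s a) = Polynomial.C (monomial (s.erase u) a) * Polynomial.X ^ s u := by
  have hsplit : monomial s a = monomial (s.erase u) a * (X u : DiffPoly Y K) ^ s u := by
    rw [X_pow_eq_monomial, monomial_mul, mul_one, Finsupp.erase_add_single]
  have hfree : u ∉ (monomial (s.erase u) a : DiffPoly Y K).vars := by
    by_cases ha : a = 0
    · simp [ha]
    · simp [vars_monomial ha]
  rw [hsplit, map_mul, map_pow, toUniv_of_notMem_vars hfree, toUniv_X_self]

theorem eval_X_toUniv (u : Deriv Y) (f : DiffPoly Y K) : (toUniv u f).eval (X u) = f := by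
  have h : ((Polynomial.aeval (X u : DiffPoly Y K)).restrictScalars K).comp (toUniv u) =
      AlgHom.id K (DiffPoly Y K) := by
    refine algHom_ext fun v => ?_
    by_cases hv : v = u <;> simp [toUniv, hv]
  simpa using DFunLike.congr_fun h f

theorem coeff_toUniv (u : Deriv Y) (d : ℕ) (f : DiffPoly Y K) :
    (toUniv u f).coeff d = coeffIn u d f := by
  conv_lhs => rw [f.as_sum]
  rw [map_sum, Polynomial.finsetSum_coeff, coeffIn, Finset.sum_filter]
  refine Finset.sum_congr rfl fun s _ => ?_
  rw [toUniv_monomial, Polynomial.coeff_C_mul_X_pow]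
  simp only [eq_comm]

theorem vars_coeffIn_subset [DecidableEq (Deriv Y)] (u : Deriv Y) (d : ℕ) (f : DiffPoly Y K) :
    (coeffIn u d f).vars ⊆ f.vars.erase u := by
  have h : coeffIn u d f ∈ supported K (f.vars.erase u : Set (Deriv Y)) := by
    refine sum_mem fun s hs => mem_supported.mpr fun v hv => ?_
    have hs := (Finset.mem_filter.mp hs).1
    rw [vars_monomial (mem_support_iff.mp hs)] at hv
    obtain ⟨hvs, hvu⟩ : v ∈ s.support ∧ v ≠ u := by simpa using hv
    exact Finset.mem_coe.mpr
      (Finset.mem_erase.mpr ⟨hvu, (mem_vars_iff_mem_support _).mpr ⟨s, hs, hvs⟩⟩)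
  exact fun v hv => mem_supported.mp h hv

theorem notMem_vars_coeffIn (u : Deriv Y) (d : ℕ) (f : DiffPoly Y K) :
    u ∉ (coeffIn u d f).vars := by
  classical exact fun h => Finset.notMem_erase u _ (vars_coeffIn_subset u d f h)

theorem degreeOf_coeffIn_le (u v : Deriv Y) (d : ℕ) (f : DiffPoly Y K) :
    (coeffIn u d f).degreeOf v ≤ f.degreeOf v := by
  classical
  refine (degreeOf_sum_le v _ _).trans (Finset.sup_le fun s hs => ?_)
  have hs := (Finset.mem_filter.mp hs).1
  rw [degreeOf_monomial_eq _ _ (mem_support_iff.mp hs)]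
  refine le_trans ?_ (monomial_le_degreeOf v hs)
  rw [Finsupp.erase_apply]
  split_ifs <;> omega

theorem coeffIn_eq_zero {u : Deriv Y} {d : ℕ} {f : DiffPoly Y K} (h : f.degreeOf u < d) :
    coeffIn u d f = 0 := by
  rw [coeffIn, Finset.filter_false_of_mem, Finset.sum_empty]
  exact fun s hs hd => ((monomial_le_degreeOf u hs).trans_lt h).ne hd

theorem degreeOf_le_of_coeffIn {u : Deriv Y} {n : ℕ} {f : DiffPoly Y K}
    (h : ∀ d, n < d → coeffIn u d f = 0) : f.degreeOf u ≤ n := by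
  have hn : (toUniv u f).natDegree < n + 1 := Nat.lt_succ_of_le <|
    Polynomial.natDegree_le_iff_coeff_eq_zero.mpr fun d hd => by rw [coeff_toUniv, h d hd]
  rw [← eval_X_toUniv u f, Polynomial.eval_eq_sum_range' hn]
  refine (degreeOf_sum_le u _ _).trans (Finset.sup_le fun d hd => ?_)
  refine (degreeOf_mul_le _ _ _).trans ?_
  have hfree : ((toUniv u f).coeff d).degreeOf u = 0 := by
    by_contra hne
    exact notMem_vars_coeffIn u d f
      (mem_vars_iff_degreeOf_ne_zero.mpr (coeff_toUniv u d f ▸ hne))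
  rw [hfree, degreeOf_X_self_pow]
  have := Finset.mem_range.mp hd
  omega

theorem coeffIn_add (u : Deriv Y) (d : ℕ) (f g : DiffPoly Y K) :
    coeffIn u d (f + g) = coeffIn u d f + coeffIn u d g := by
  simp only [← coeff_toUniv, map_add, Polynomial.coeff_add]

theorem coeffIn_sub (u : Deriv Y) (d : ℕ) (f g : DiffPoly Y K) :
    coeffIn u d (f - g) = coeffIn u d f - coeffIn u d g := by
  simp only [← coeff_toUniv, map_sub, Polynomial.coeff_sub]

theorem coeffIn_mul_right {u : Deriv Y} {p : DiffPoly Y K} (h : u ∉ p.vars) (d : ℕ)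
    (f : DiffPoly Y K) : coeffIn u d (f * p) = coeffIn u d f * p := by
  rw [← coeff_toUniv, map_mul, toUniv_of_notMem_vars h, Polynomial.coeff_mul_C, coeff_toUniv]

theorem coeffIn_mul_left {u : Deriv Y} {p : DiffPoly Y K} (h : u ∉ p.vars) (d : ℕ)
    (f : DiffPoly Y K) : coeffIn u d (p * f) = p * coeffIn u d f := by
  rw [mul_comm, coeffIn_mul_right h, mul_comm]

theorem coeffIn_X_pow_mul {u : Deriv Y} {r d : ℕ} (h : r ≤ d) (f : DiffPoly Y K) :
    coeffIn u d (X u ^ r * f) = coeffIn u (d - r) f := by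
  rw [← coeff_toUniv, map_mul, map_pow, toUniv_X_self, Polynomial.coeff_X_pow_mul', if_pos h,
    coeff_toUniv]

theorem degreeOf_cancel_leading_le {u : Deriv Y} {p f : DiffPoly Y K}
    (h : p.degreeOf u ≤ f.degreeOf u) :
    (coeffIn u (p.degreeOf u) p * f - coeffIn u (f.degreeOf u) f *
      (X u ^ (f.degreeOf u - p.degreeOf u) * p)).degreeOf u ≤ f.degreeOf u - 1 := by
  refine degreeOf_le_of_coeffIn fun d hd => ?_
  rw [coeffIn_sub, coeffIn_mul_left (notMem_vars_coeffIn _ _ _),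
    coeffIn_mul_left (notMem_vars_coeffIn _ _ _), coeffIn_X_pow_mul (by omega)]
  rcases (show f.degreeOf u ≤ d by omega).eq_or_lt with rfl | hlt
  · rw [Nat.sub_sub_self h, mul_comm, sub_self]
  · have hp : p.degreeOf u < d - (f.degreeOf u - p.degreeOf u) := by omega
    rw [coeffIn_eq_zero hlt, coeffIn_eq_zero hp, mul_zero, mul_zero, sub_self]

theorem exists_pseudoRem {u : Deriv Y} {p : DiffPoly Y K} (hp : 0 < p.degreeOf u)
    (f : DiffPoly Y K) :
    ∃ (e : ℕ) (q g : DiffPoly Y K), g.degreeOf u < p.degreeOf u ∧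
      coeffIn u (p.degreeOf u) p ^ e * f = q * p + g := by
  induction hn : f.degreeOf u using Nat.strong_induction_on generalizing f with
  | _ n ih =>
    rcases lt_or_ge (f.degreeOf u) (p.degreeOf u) with hlt | hle
    · exact ⟨0, 0, f, hlt, by ring⟩
    · have hdeg := degreeOf_cancel_leading_le hle
      obtain ⟨e, q, g, hg, he⟩ := ih _ (hdeg.trans_lt (by omega)) _ rfl
      refine ⟨e + 1, q + coeffIn u (p.degreeOf u) p ^ e * coeffIn u (f.degreeOf u) f *
        X u ^ (f.degreeOf u - p.degreeOf u), g, hg, ?_⟩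
      linear_combination he

/- If the remainder had higher degree in `v` than `f`, its top coefficient in `v` would be a nonzero
multiple of `p`, although its degree in `u` is less than that of `p`. -/
theorem degreeOf_pseudoRem_le {u v : Deriv Y} {a p f q g : DiffPoly Y K} (hva : v ∉ a.vars)
    (hvp : v ∉ p.vars) (hg : g.degreeOf u < p.degreeOf u) (h : a * f = q * p + g) :
    g.degreeOf v ≤ f.degreeOf v := by
  refine degreeOf_le_of_coeffIn fun d hd => ?_
  have hcoeff : coeffIn v d q * p + coeffIn v d g = 0 := by
    rw [← coeffIn_mul_right hvp, ← coeffIn_add, ← h, coeffIn_mul_left hva, coeffIn_eq_zero hd,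
      mul_zero]
  by_cases hq : coeffIn v d q = 0
  · simpa [hq] using hcoeff
  · have hp : p ≠ 0 := ne_zero_of_degreeOf_ne_zero (by omega : p.degreeOf u ≠ 0)
    have hdeg := degreeOf_mul_eq (n := u) hq hp
    rw [eq_neg_of_add_eq_zero_left hcoeff, degreeOf_neg] at hdeg
    have := degreeOf_coeffIn_le v u d g
    omega

end univariate

section rankings

variable {Y : Type*}

theorem shift_injective (k : ℕ) : Function.Injective (Deriv.shift k : Deriv Y → Deriv Y) := by
  intro u v h
  obtain ⟨hvar, hord⟩ := Deriv.ext_iff.mp h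
  exact Deriv.ext hvar (Nat.add_right_cancel hord)

variable [LinearOrder (Deriv Y)]

theorem IsRanking.shift_lt_shift (hR : IsRanking Y) {u v : Deriv Y} (h : u < v) (k : ℕ) :
    u.shift k < v.shift k :=
  lt_of_le_of_ne (hR.shift_le_shift k v u h.le) fun e => h.ne (shift_injective k e)

theorem IsRanking.strictMono_mk (hR : IsRanking Y) (y : Y) :
    StrictMono fun j => (⟨y, j⟩ : Deriv Y) :=
  strictMono_nat_of_lt_succ fun j =>
    lt_of_le_of_ne (hR.le_shift 1 ⟨y, j⟩) fun e => by simpa using congrArg Deriv.ord e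

theorem IsRanking.lt_shift_one (hR : IsRanking Y) (u : Deriv Y) : u < u.shift 1 :=
  hR.strictMono_mk u.var u.ord.lt_succ_self

end rankings

section ranks

variable {Y K : Type*} [Field K] [LinearOrder (Deriv Y)]

theorem ld_eq_coe {f : DiffPoly Y K} {u : Deriv Y} :
    ld f = u ↔ u ∈ f.vars ∧ ∀ v ∈ f.vars, v ≤ u :=
  ⟨fun h => ⟨Finset.mem_of_max h, fun _ hv => Finset.le_max_of_eq hv h⟩, fun h =>
    le_antisymm (Finset.max_le fun v hv => WithBot.coe_le_coe.mpr (h.2 v hv)) (Finset.le_max h.1)⟩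

theorem degreeOf_pos_of_ld {f : DiffPoly Y K} {u : Deriv Y} (h : ld f = u) :
    0 < f.degreeOf u :=
  Nat.pos_of_ne_zero (mem_vars_iff_degreeOf_ne_zero.mp (ld_eq_coe.mp h).1)

theorem lv_of_ld {f : DiffPoly Y K} {u : Deriv Y} (h : ld f = u) : lv f = u.var := by
  rw [lv, h, WithBot.map_coe]

theorem initial_of_ld {f : DiffPoly Y K} {u : Deriv Y} (h : ld f = u) :
    initial f = coeffIn u (f.degreeOf u) f := by
  rw [initial, h, WithBot.recBotCoe_coe]

theorem separant_of_ld {f : DiffPoly Y K} {u : Deriv Y} (h : ld f = u) :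
    separant f = pderiv u f := by
  rw [separant, h, WithBot.recBotCoe_coe]

theorem vars_initial_subset {f : DiffPoly Y K} {u : Deriv Y} (h : ld f = u) :
    (initial f).vars ⊆ f.vars := by
  rw [initial_of_ld h]
  exact (vars_coeffIn_subset u _ f).trans (Finset.erase_subset _ _)

theorem rk_of_ld {f : DiffPoly Y K} {u : Deriv Y} (h : ld f = u) :
    rk f = (toLex (u, f.degreeOf u) : Deriv Y ×ₗ ℕ) := by
  rw [rk, h, WithBot.map_coe]

theorem rk_eq_coe {f : DiffPoly Y K} {u : Deriv Y} {n : ℕ} :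
    rk f = (toLex (u, n) : Deriv Y ×ₗ ℕ) ↔ ld f = u ∧ f.degreeOf u = n := by
  constructor
  · intro h
    obtain ⟨v, hv, hvn⟩ := WithBot.map_eq_some_iff.mp h
    obtain ⟨rfl, rfl⟩ := Prod.mk.inj (toLex.injective hvn)
    exact ⟨hv, rfl⟩
  · rintro ⟨h, rfl⟩
    exact rk_of_ld h

theorem rk_eq_rk_iff {f g : DiffPoly Y K} {u : Deriv Y} (hf : ld f = u) :
    rk g = rk f ↔ ld g = u ∧ g.degreeOf u = f.degreeOf u := by
  rw [rk_of_ld hf, rk_eq_coe]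

theorem le_of_rk_le {f g : DiffPoly Y K} {u v : Deriv Y} (hf : ld f = u) (hg : ld g = v)
    (h : rk f ≤ rk g) : u ≤ v := by
  rw [rk_of_ld hf, rk_of_ld hg, WithBot.coe_le_coe, Prod.Lex.toLex_le_toLex] at h
  exact h.elim le_of_lt fun h => h.1.le

theorem rk_lt_of_lt {f g : DiffPoly Y K} {u v : Deriv Y} (hf : ld f = u) (hg : ld g = v)
    (h : u < v) : rk f < rk g := by
  rw [rk_of_ld hf, rk_of_ld hg, WithBot.coe_lt_coe, Prod.Lex.toLex_lt_toLex]
  exact Or.inl h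

theorem algReduced_iff_of_ld {f g : DiffPoly Y K} {u : Deriv Y} (hg : ld g = u) :
    AlgReduced f g ↔ f.degreeOf u < g.degreeOf u := by
  simp [AlgReduced, hg]

theorem AlgReduced.of_rk_eq {f g h : DiffPoly Y K} {u : Deriv Y} (hg : ld g = u)
    (hgh : rk h = rk g) (hf : AlgReduced f h) : AlgReduced f g := by
  obtain ⟨hu, hdeg⟩ := (rk_eq_rk_iff hg).mp hgh
  rwa [algReduced_iff_of_ld hu, hdeg, ← algReduced_iff_of_ld hg] at hf

theorem separant_ne_zero [CharZero K] {f : DiffPoly Y K} {u : Deriv Y} (h : ld f = u) :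
    separant f ≠ 0 := by
  rw [separant_of_ld h]
  exact pderiv_ne_zero (ld_eq_coe.mp h).1

theorem vars_separant_lt (hR : IsRanking Y) {f : DiffPoly Y K} {u : Deriv Y} (h : ld f = u) :
    ∀ v ∈ (separant f).vars, v < u.shift 1 := fun v hv =>
  ((ld_eq_coe.mp h).2 v (vars_pderiv_subset u f (separant_of_ld h ▸ hv))).trans_lt
    (hR.lt_shift_one u)

end ranks

section derivation

variable {Y K : Type*} [Field K] [Differential K]

theorem vars_coeffDeriv_subset (f : DiffPoly Y K) : (coeffDeriv f).vars ⊆ f.vars := by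
  intro v hv
  obtain ⟨s, hs, hvs⟩ := (mem_vars_iff_mem_support _).mp hv
  rw [mem_support_iff, coeff_coeffDeriv] at hs
  refine (mem_vars_iff_mem_support _).mpr ⟨s, mem_support_iff.mpr fun h => hs ?_, hvs⟩
  rw [h, map_zero]

theorem δ_eq_coeffDeriv_add_sum (f : DiffPoly Y K) :
    δ f = coeffDeriv f + ∑ w ∈ f.vars, pderiv w f * X (w.shift 1) := by
  have hsum : ∀ g : DiffPoly Y K, (∑ w ∈ f.vars, (X (w.shift 1) : DiffPoly Y K) • pderiv w) g =
      ∑ w ∈ f.vars, pderiv w g * X (w.shift 1) := fun g => by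
    rw [← Derivation.coeFnAddMonoidHom_apply, map_sum, Finset.sum_apply]
    simp only [Derivation.coeFnAddMonoidHom_apply, Derivation.smul_apply, smul_eq_mul, mul_comm]
  have h : mkDerivation K (fun u : Deriv Y => (X (u.shift 1) : DiffPoly Y K)) f =
      (∑ w ∈ f.vars, (X (w.shift 1) : DiffPoly Y K) • pderiv w) f := by
    refine derivation_eq_of_forall_mem_vars fun v hv => ?_
    rw [mkDerivation_X, hsum, Finset.sum_eq_single_of_mem v hv]
    · rw [pderiv_X_self, one_mul]
    · intro w _ hw
      rw [pderiv_X_of_ne hw.symm, zero_mul]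
  exact congrArg (coeffDeriv f + ·) (h.trans (hsum f))

theorem mem_vars_δ {f : DiffPoly Y K} {v : Deriv Y} (h : v ∈ (δ f).vars) :
    v ∈ f.vars ∨ ∃ w ∈ f.vars, v = w.shift 1 := by
  classical
  rw [δ_eq_coeffDeriv_add_sum] at h
  rcases Finset.mem_union.mp (vars_add_subset _ _ h) with h | h
  · exact Or.inl (vars_coeffDeriv_subset f h)
  · obtain ⟨w, hw, h⟩ := Finset.mem_biUnion.mp (vars_sum_subset _ _ h)
    exact (Finset.mem_union.mp (vars_pderiv_mul_X_subset w _ f h)).imp_right fun h =>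
      ⟨w, hw, Finset.mem_singleton.mp h⟩

variable [LinearOrder (Deriv Y)]

theorem exists_δ_eq_separant_mul (hR : IsRanking Y) {f : DiffPoly Y K} {u : Deriv Y}
    (h : ld f = u) :
    ∃ r : DiffPoly Y K, δ f = separant f * X (u.shift 1) + r ∧ ∀ v ∈ r.vars, v < u.shift 1 := by
  obtain ⟨hu, hle⟩ := ld_eq_coe.mp h
  have hlt : ∀ v ∈ f.vars, v < u.shift 1 := fun v hv => (hle v hv).trans_lt (hR.lt_shift_one u)
  refine ⟨coeffDeriv f + ∑ w ∈ f.vars.erase u, pderiv w f * X (w.shift 1), ?_, fun v hv => ?_⟩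
  · rw [δ_eq_coeffDeriv_add_sum, separant_of_ld h, ← Finset.add_sum_erase _ _ hu]
    ring
  · rcases Finset.mem_union.mp (vars_add_subset _ _ hv) with hv | hv
    · exact hlt v (vars_coeffDeriv_subset f hv)
    · obtain ⟨w, hw, hv⟩ := Finset.mem_biUnion.mp (vars_sum_subset _ _ hv)
      obtain ⟨hwu, hw⟩ := Finset.mem_erase.mp hw
      rcases Finset.mem_union.mp (vars_pderiv_mul_X_subset w _ f hv) with hv | hv
      · exact hlt v hv
      · rw [Finset.mem_singleton.mp hv]
        exact hR.shift_lt_shift (lt_of_le_of_ne (hle w hw) hwu) 1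

theorem coeffIn_shift_one_δ (hR : IsRanking Y) {f : DiffPoly Y K} {u : Deriv Y} (h : ld f = u)
    {j : ℕ} : coeffIn (u.shift 1) (j + 1) (δ f) = if j = 0 then separant f else 0 := by
  obtain ⟨r, hr, hv⟩ := exists_δ_eq_separant_mul hR h
  have hs : u.shift 1 ∉ (separant f).vars := fun h' => (vars_separant_lt hR h _ h').false
  have hr' : u.shift 1 ∉ r.vars := fun h' => (hv _ h').false
  rw [hr, ← coeff_toUniv, map_add, map_mul, toUniv_of_notMem_vars hs, toUniv_of_notMem_vars hr',
    toUniv_X_self, Polynomial.coeff_add, Polynomial.coeff_C_succ, add_zero,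
    Polynomial.coeff_C_mul, Polynomial.coeff_X]
  simp

variable [CharZero K]

theorem rk_δ (hR : IsRanking Y) {f : DiffPoly Y K} {u : Deriv Y} (h : ld f = u) :
    rk (δ f) = (toLex (u.shift 1, 1) : Deriv Y ×ₗ ℕ) := by
  have hdeg : (δ f).degreeOf (u.shift 1) = 1 := by
    refine le_antisymm (degreeOf_le_of_coeffIn fun d hd => ?_) ?_
    · obtain ⟨j, rfl⟩ := Nat.exists_eq_add_of_lt hd
      rw [coeffIn_shift_one_δ hR h, if_neg (by omega)]
    · by_contra! hlt
      have hcoeff := coeffIn_shift_one_δ hR h (j := 0)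
      rw [coeffIn_eq_zero hlt, if_pos rfl] at hcoeff
      exact separant_ne_zero h hcoeff.symm
  refine rk_eq_coe.mpr ⟨ld_eq_coe.mpr ⟨?_, fun v hv => ?_⟩, hdeg⟩
  · exact mem_vars_iff_degreeOf_ne_zero.mpr (hdeg.trans_ne one_ne_zero)
  · obtain ⟨-, hle⟩ := ld_eq_coe.mp h
    rcases mem_vars_δ hv with hv | ⟨w, hw, rfl⟩
    · exact (hle v hv).trans (hR.le_shift 1 u)
    · exact hR.shift_le_shift 1 u w (hle w hw)

theorem ld_δ (hR : IsRanking Y) {f : DiffPoly Y K} {u : Deriv Y} (h : ld f = u) :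
    ld (δ f) = (u.shift 1 : Deriv Y) :=
  (rk_eq_coe.mp (rk_δ hR h)).1

theorem initial_δ (hR : IsRanking Y) {f : DiffPoly Y K} {u : Deriv Y} (h : ld f = u) :
    initial (δ f) = separant f := by
  rw [initial_of_ld (ld_δ hR h), (rk_eq_coe.mp (rk_δ hR h)).2, coeffIn_shift_one_δ hR h,
    if_pos rfl]

theorem separant_δ (hR : IsRanking Y) {f : DiffPoly Y K} {u : Deriv Y} (h : ld f = u) :
    separant (δ f) = separant f := by
  obtain ⟨r, hr, hv⟩ := exists_δ_eq_separant_mul hR h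
  rw [separant_of_ld (ld_δ hR h), hr, map_add, pderiv_mul, pderiv_X_self,
    pderiv_eq_zero_of_notMem_vars (f := r) fun h' => (hv _ h').false,
    pderiv_eq_zero_of_notMem_vars (f := separant f) fun h' => (vars_separant_lt hR h _ h').false]
  ring

theorem rk_δ_congr (hR : IsRanking Y) {f g : DiffPoly Y K} {u : Deriv Y} (hf : ld f = u)
    (h : rk g = rk f) : rk (δ g) = rk (δ f) := by
  rw [rk_δ hR hf, rk_δ hR ((rk_eq_rk_iff hf).mp h).1]

theorem ld_δ_iterate (hR : IsRanking Y) {f : DiffPoly Y K} {u : Deriv Y} (h : ld f = u) (j : ℕ) :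
    ld (δ^[j] f) = (u.shift j : Deriv Y) := by
  induction j with
  | zero => exact h
  | succ j ih => rw [Function.iterate_succ_apply', ld_δ hR ih]; rfl

end derivation

section saturation

variable {Y K : Type*} [Field K]

theorem powers_mono {G H : Set (DiffPoly Y K)} (h : G ⊆ H) : powers G ⊆ powers H :=
  Submonoid.closure_mono h

/-- The elements that are congruent modulo `I` to an element of `H^∞`; as a set, this is
`H^∞ + I`. -/
def powersMod (H : Set (DiffPoly Y K)) (I : Ideal (DiffPoly Y K)) : Submonoid (DiffPoly Y K) :=
  ((Submonoid.closure H).map (Ideal.Quotient.mk I)).comap (Ideal.Quotient.mk I)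

theorem mem_powersMod {H : Set (DiffPoly Y K)} {I : Ideal (DiffPoly Y K)} {a : DiffPoly Y K} :
    a ∈ powersMod H I ↔ ∃ h ∈ powers H, h - a ∈ I := by
  simp [powersMod, powers, Ideal.Quotient.eq]

theorem coe_powersMod (H : Set (DiffPoly Y K)) (I : Ideal (DiffPoly Y K)) :
    (powersMod H I : Set (DiffPoly Y K)) = powers H + (I : Set (DiffPoly Y K)) := by
  ext a
  rw [SetLike.mem_coe, mem_powersMod, Set.mem_add]
  constructor
  · rintro ⟨h, hh, ha⟩
    exact ⟨h, hh, a - h, by simpa using I.neg_mem ha, add_sub_cancel h a⟩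
  · rintro ⟨h, hh, b, hb, rfl⟩
    exact ⟨h, hh, by simpa using hb⟩

theorem powers_subset_powersMod (H : Set (DiffPoly Y K)) (I : Ideal (DiffPoly Y K)) :
    powers H ⊆ powersMod H I := fun h hh => mem_powersMod.mpr ⟨h, hh, by simp⟩

theorem powersMod_mono {G H : Set (DiffPoly Y K)} {I J : Ideal (DiffPoly Y K)} (hH : G ⊆ H)
    (hI : I ≤ J) : powersMod G I ≤ powersMod H J := fun a ha => by
  obtain ⟨h, hh, ha⟩ := mem_powersMod.mp ha
  exact mem_powersMod.mpr ⟨h, powers_mono hH hh, hI ha⟩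

theorem mem_powersMod_congr {H : Set (DiffPoly Y K)} {I : Ideal (DiffPoly Y K)}
    {a b : DiffPoly Y K} (h : a - b ∈ I) : a ∈ powersMod H I ↔ b ∈ powersMod H I := by
  rw [powersMod, Submonoid.mem_comap, Submonoid.mem_comap, Ideal.Quotient.eq.mpr h]

theorem saturation_mono {A A' S S' : Set (DiffPoly Y K)} (hA : A ⊆ A') (hS : S ⊆ S') :
    saturation A S ⊆ saturation A' S' := fun _ ⟨s, hs, ha⟩ => ⟨s, powers_mono hS hs, hA ha⟩

theorem subset_saturation (A S : Set (DiffPoly Y K)) : A ⊆ saturation A S := fun a ha =>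
  ⟨1, (Submonoid.closure S).one_mem, by rwa [one_mul]⟩

theorem saturation_eq_univ {H : Set (DiffPoly Y K)} {I : Ideal (DiffPoly Y K)}
    (h : 0 ∈ powersMod H I) : saturation (I : Set (DiffPoly Y K)) H = Set.univ := by
  obtain ⟨s, hs, hsI⟩ := mem_powersMod.mp h
  rw [sub_zero] at hsI
  exact Set.eq_univ_of_forall fun a => ⟨s, hs, I.mul_mem_right a hsI⟩

/-- The saturation `I : H^∞` of an ideal, as an ideal. -/
def saturationIdeal (I : Ideal (DiffPoly Y K)) (H : Set (DiffPoly Y K)) :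
    Ideal (DiffPoly Y K) where
  carrier := saturation I H
  add_mem' := by
    rintro a b ⟨s, hs, ha⟩ ⟨t, ht, hb⟩
    refine ⟨s * t, (Submonoid.closure H).mul_mem hs ht, ?_⟩
    have hsum : s * t * (a + b) = t * (s * a) + s * (t * b) := by ring
    exact hsum ▸ I.add_mem (I.mul_mem_left _ ha) (I.mul_mem_left _ hb)
  zero_mem' := subset_saturation _ _ I.zero_mem
  smul_mem' := by
    rintro c a ⟨s, hs, ha⟩
    refine ⟨s, hs, ?_⟩
    rw [smul_eq_mul, mul_left_comm]
    exact I.mul_mem_left c ha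

end saturation

section diffIdeal

variable {Y K : Type*} [Field K] [Differential K]

theorem subset_diffIdeal (F : Set (DiffPoly Y K)) : F ⊆ diffIdeal F := fun _ hf =>
  Submodule.mem_sInf.mpr fun _ hI => hI.1 hf

theorem δ_mem_diffIdeal {F : Set (DiffPoly Y K)} {f : DiffPoly Y K} (hf : f ∈ diffIdeal F) :
    δ f ∈ diffIdeal F :=
  Submodule.mem_sInf.mpr fun I hI => hI.2 f (Submodule.mem_sInf.mp hf I hI)

theorem diffIdeal_le {F : Set (DiffPoly Y K)} {I : Ideal (DiffPoly Y K)} (h : F ⊆ I)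
    (hδ : ∀ f ∈ I, δ f ∈ I) : diffIdeal F ≤ I :=
  sInf_le ⟨h, hδ⟩

theorem diffIdeal_le_diffIdeal {F G : Set (DiffPoly Y K)} (h : F ⊆ diffIdeal G) :
    diffIdeal F ≤ diffIdeal G :=
  diffIdeal_le h fun _ => δ_mem_diffIdeal

theorem diffIdeal_mono {F G : Set (DiffPoly Y K)} (h : F ⊆ G) : diffIdeal F ≤ diffIdeal G :=
  diffIdeal_le_diffIdeal (h.trans (subset_diffIdeal G))

theorem diffIdeal_subset_saturation {F G H : Set (DiffPoly Y K)}
    (h : F ⊆ saturation (diffIdeal G) H) :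
    (diffIdeal F : Set (DiffPoly Y K)) ⊆ saturation (diffIdeal G) H := by
  refine diffIdeal_le (I := saturationIdeal (diffIdeal G) H) h ?_
  rintro f ⟨s, hs, hf⟩
  refine ⟨s * s, (Submonoid.closure H).mul_mem hs hs, ?_⟩
  have hδ : δ (s * f) = s * δ f + f * δ s := Derivation.leibniz δ s f
  have hsum : s * s * δ f = s * δ (s * f) - δ s * (s * f) := by rw [hδ]; ring
  exact hsum ▸ sub_mem (Ideal.mul_mem_left _ s (δ_mem_diffIdeal hf)) (Ideal.mul_mem_left _ _ hf)

end diffIdeal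

section pseudoDivision

variable {Y K : Type*} [Field K] [LinearOrder (Deriv Y)] {S T : Set (DiffPoly Y K)}
  {f g : DiffPoly Y K} {u v : Deriv Y}

theorem initSep_mono (h : S ⊆ T) : initSep S ⊆ initSep T :=
  Set.union_subset_union (Set.image_mono h) (Set.image_mono h)

theorem initial_mem_initSep (h : f ∈ S) : initial f ∈ initSep S :=
  Or.inl (Set.mem_image_of_mem _ h)

theorem separant_mem_initSep (h : f ∈ S) : separant f ∈ initSep S :=
  Or.inr (Set.mem_image_of_mem _ h)

theorem PseudoDivision.degreeOf_le (h : PseudoDivision S f g) (hv : ∀ p ∈ S, v ∉ p.vars) :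
    g.degreeOf v ≤ f.degreeOf v := by
  obtain ⟨p, hp, w, hw, -, hg, e, q, he⟩ := h
  have hinit : v ∉ (initial p ^ e).vars := fun hmem =>
    hv p hp (vars_initial_subset hw (vars_pow _ _ hmem))
  exact degreeOf_pseudoRem_le hinit (hv p hp) hg he

theorem degreeOf_le_of_pseudoDivisions (h : Relation.ReflTransGen (PseudoDivision S) f g)
    (hv : ∀ p ∈ S, v ∉ p.vars) : g.degreeOf v ≤ f.degreeOf v := by
  induction h with
  | refl => exact le_rfl
  | tail _ hstep ih => exact (hstep.degreeOf_le hv).trans ih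

theorem mem_vars_of_pseudoDivisions (h : Relation.ReflTransGen (PseudoDivision S) f g)
    (hv : v ∈ g.vars) : v ∈ f.vars ∨ ∃ p ∈ S, v ∈ p.vars := by
  by_contra! hnot
  have hdeg := degreeOf_le_of_pseudoDivisions h hnot.2
  have hf := hnot.1
  rw [mem_vars_iff_degreeOf_ne_zero] at hv hf
  omega

theorem PseudoDivision.restrict (h : PseudoDivision S f g) (hS : ∀ p ∈ S, ld p ≠ u)
    (hf : ∀ v ∈ f.vars, v ≤ u) : PseudoDivision {p ∈ S | ∀ v ∈ p.vars, v < u} f g := by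
  obtain ⟨p, hp, w, hw, hdeg, hrem⟩ := h
  have hwf : w ∈ f.vars :=
    mem_vars_iff_degreeOf_ne_zero.mpr ((degreeOf_pos_of_ld hw).trans_le hdeg).ne'
  have hwu : w < u := lt_of_le_of_ne (hf w hwf) fun e => hS p hp (e ▸ hw)
  exact ⟨p, ⟨hp, fun v hv => ((ld_eq_coe.mp hw).2 v hv).trans_lt hwu⟩, w, hw, hdeg, hrem⟩

theorem restrict_pseudoDivisions (h : Relation.ReflTransGen (PseudoDivision S) f g)
    (hS : ∀ p ∈ S, ld p ≠ u) (hf : ∀ v ∈ f.vars, v ≤ u) :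
    Relation.ReflTransGen (PseudoDivision {p ∈ S | ∀ v ∈ p.vars, v < u}) f g ∧
      ∀ v ∈ g.vars, v ≤ u := by
  induction h with
  | refl => exact ⟨.refl, hf⟩
  | tail _ hstep ih =>
    have hrestrict := ih.1.tail (hstep.restrict hS ih.2)
    refine ⟨hrestrict, fun v hv => ?_⟩
    rcases mem_vars_of_pseudoDivisions hrestrict hv with hv | ⟨p, hp, hv⟩
    · exact hf v hv
    · exact (hp.2 v hv).le

end pseudoDivision

section span

variable {Y K : Type*} [Field K] {S : Set (DiffPoly Y K)} {x : DiffPoly Y K} {u : Deriv Y}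

theorem coeffIn_mem_span (hS : ∀ p ∈ S, u ∉ p.vars) (d : ℕ) (hx : x ∈ Ideal.span S) :
    coeffIn u d x ∈ Ideal.span S := by
  induction hx using Submodule.closure_induction with
  | zero => simp [coeffIn]
  | add x z _ _ hx hz => exact coeffIn_add u d x z ▸ add_mem hx hz
  | smul_mem r p hp =>
    rw [smul_eq_mul, coeffIn_mul_right (hS p hp)]
    exact Ideal.mul_mem_left _ _ (Ideal.subset_span hp)

theorem pderiv_mem_span (hS : ∀ p ∈ S, u ∉ p.vars) (hx : x ∈ Ideal.span S) :
    pderiv u x ∈ Ideal.span S := by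
  induction hx using Submodule.closure_induction with
  | zero => simp
  | add x z _ _ hx hz => exact map_add (pderiv u) x z ▸ add_mem hx hz
  | smul_mem r p hp =>
    rw [smul_eq_mul, pderiv_mul, pderiv_eq_zero_of_notMem_vars (hS p hp), mul_zero, add_zero]
    exact Ideal.mul_mem_left _ _ (Ideal.subset_span hp)

end span

section pseudoCongr

variable {Y K : Type*} [Field K] [LinearOrder (Deriv Y)] {S T : Set (DiffPoly Y K)}
  {f g x z : DiffPoly Y K} {u : Deriv Y}

/-- `z` is congruent modulo the ideal `(S)` to a multiple of `x` by a product of initials of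
elements of `S`. This is the relation between a polynomial and its pseudo-remainders that passes
to initials and separants. -/
def PseudoCongr (S : Set (DiffPoly Y K)) (x z : DiffPoly Y K) : Prop :=
  ∃ a ∈ powers (initial '' S), a * x - z ∈ Ideal.span S

theorem PseudoCongr.refl (S : Set (DiffPoly Y K)) (x : DiffPoly Y K) : PseudoCongr S x x :=
  ⟨1, (Submonoid.closure _).one_mem, by simp⟩

theorem PseudoCongr.trans {w : DiffPoly Y K} (hxz : PseudoCongr S x z)
    (hzw : PseudoCongr S z w) : PseudoCongr S x w := by
  obtain ⟨a, ha, hxz⟩ := hxz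
  obtain ⟨b, hb, hzw⟩ := hzw
  refine ⟨b * a, (Submonoid.closure _).mul_mem hb ha, ?_⟩
  have hsum : b * a * x - w = b * (a * x - z) + (b * z - w) := by ring
  exact hsum ▸ add_mem (Ideal.mul_mem_left _ _ hxz) hzw

theorem PseudoCongr.mono (hST : S ⊆ T) (h : PseudoCongr S x z) : PseudoCongr T x z := by
  obtain ⟨a, ha, h⟩ := h
  exact ⟨a, powers_mono (Set.image_mono hST) ha, Ideal.span_mono hST h⟩

theorem PseudoDivision.pseudoCongr (h : PseudoDivision S f g) : PseudoCongr S f g := by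
  obtain ⟨p, hp, -, -, -, -, e, q, he⟩ := h
  refine ⟨initial p ^ e, pow_mem (Submonoid.subset_closure (Set.mem_image_of_mem _ hp)) e, ?_⟩
  rw [he, add_sub_cancel_right]
  exact Ideal.mul_mem_left _ _ (Ideal.subset_span hp)

theorem pseudoCongr_of_pseudoDivisions (h : Relation.ReflTransGen (PseudoDivision S) f g) :
    PseudoCongr S f g := by
  induction h with
  | refl => exact .refl S f
  | tail _ hstep ih => exact ih.trans hstep.pseudoCongr

theorem notMem_vars_of_mem_powers_initial (hS : ∀ p ∈ S, u ∉ p.vars) {a : DiffPoly Y K}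
    (ha : a ∈ powers (initial '' S)) : u ∉ a.vars := by
  refine notMem_vars_of_mem_closure ?_ ha
  rintro _ ⟨p, hp, rfl⟩ hu
  refine hS p hp ?_
  cases hld : ld p with
  | bot => simpa only [initial, hld, WithBot.recBotCoe_bot] using hu
  | coe v => exact vars_initial_subset hld hu

theorem PseudoCongr.coeffIn (hS : ∀ p ∈ S, u ∉ p.vars) (h : PseudoCongr S x z) (d : ℕ) :
    PseudoCongr S (coeffIn u d x) (coeffIn u d z) := by
  obtain ⟨a, ha, h⟩ := h
  refine ⟨a, ha, ?_⟩
  rw [← coeffIn_mul_left (notMem_vars_of_mem_powers_initial hS ha), ← coeffIn_sub]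
  exact coeffIn_mem_span hS d h

theorem PseudoCongr.pderiv (hS : ∀ p ∈ S, u ∉ p.vars) (h : PseudoCongr S x z) :
    PseudoCongr S (pderiv u x) (pderiv u z) := by
  obtain ⟨a, ha, h⟩ := h
  refine ⟨a, ha, ?_⟩
  have hmem := pderiv_mem_span hS h
  rwa [map_sub, pderiv_mul,
    pderiv_eq_zero_of_notMem_vars (notMem_vars_of_mem_powers_initial hS ha), zero_mul,
    zero_add] at hmem

theorem PseudoCongr.mem_ideal {I : Ideal (DiffPoly Y K)} (hI : S ⊆ I) (h : PseudoCongr S x z)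
    (hx : x ∈ I) : z ∈ I := by
  obtain ⟨a, -, h⟩ := h
  exact (I.sub_mem_iff_right (I.mul_mem_left a hx)).mp (Ideal.span_le.mpr hI h)

theorem PseudoCongr.mem_powersMod {H : Set (DiffPoly Y K)} {I : Ideal (DiffPoly Y K)}
    (hI : S ⊆ I) (hH : initial '' S ⊆ powersMod H I) (h : PseudoCongr S x z)
    (hx : x ∈ powersMod H I) : z ∈ powersMod H I := by
  obtain ⟨a, ha, h⟩ := h
  exact (mem_powersMod_congr (Ideal.span_le.mpr hI h)).mp
    (mul_mem (Submonoid.closure_le.mpr hH ha) hx)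

theorem PseudoCongr.mem_saturation {A H : Set (DiffPoly Y K)} (hH : initial '' S ⊆ H)
    (hA : ∀ c ∈ A, ∀ b, b - c ∈ Ideal.span S → b ∈ A) (h : PseudoCongr S x z) (hz : z ∈ A) :
    x ∈ saturation A H := by
  obtain ⟨a, ha, h⟩ := h
  exact ⟨a, powers_mono hH ha, hA z hz _ h⟩

theorem pseudoCongr_coeffIn_of_pseudoDivisions (hS : ∀ p ∈ S, ld p ≠ u) (hf : ld f = u)
    (h : Relation.ReflTransGen (PseudoDivision S) f g) (d : ℕ) :
    PseudoCongr S (coeffIn u d f) (coeffIn u d g) :=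
  ((pseudoCongr_of_pseudoDivisions (restrict_pseudoDivisions h hS (ld_eq_coe.mp hf).2).1).coeffIn
    (fun _ hp hu => (hp.2 u hu).false) d).mono (Set.sep_subset _ _)

theorem pseudoCongr_initial_of_rk_eq (hS : ∀ p ∈ S, ld p ≠ u) (hf : ld f = u)
    (h : Relation.ReflTransGen (PseudoDivision S) f g) (hrk : rk g = rk f) :
    PseudoCongr S (initial f) (initial g) := by
  obtain ⟨hg, hdeg⟩ := (rk_eq_rk_iff hf).mp hrk
  rw [initial_of_ld hf, initial_of_ld hg, hdeg]
  exact pseudoCongr_coeffIn_of_pseudoDivisions hS hf h _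

theorem pseudoCongr_separant_of_rk_eq (hS : ∀ p ∈ S, ld p ≠ u) (hf : ld f = u)
    (h : Relation.ReflTransGen (PseudoDivision S) f g) (hrk : rk g = rk f) :
    PseudoCongr S (separant f) (separant g) := by
  rw [separant_of_ld hf, separant_of_ld ((rk_eq_rk_iff hf).mp hrk).1]
  exact ((pseudoCongr_of_pseudoDivisions
    (restrict_pseudoDivisions h hS (ld_eq_coe.mp hf).2).1).pderiv
      fun _ hp hu => (hp.2 u hu).false).mono (Set.sep_subset _ _)

/- A change of rank means that the leading coefficient has been cancelled. -/
theorem pseudoCongr_initial_zero_of_rk_ne (hS : ∀ p ∈ S, ld p ≠ u) (hf : ld f = u)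
    (h : Relation.ReflTransGen (PseudoDivision S) f g) (hrk : rk g ≠ rk f) :
    PseudoCongr S (initial f) 0 := by
  obtain ⟨hrestrict, hle⟩ := restrict_pseudoDivisions h hS (ld_eq_coe.mp hf).2
  have hdeg : g.degreeOf u < f.degreeOf u := by
    refine lt_of_le_of_ne (degreeOf_le_of_pseudoDivisions hrestrict
      fun p hp hu => (hp.2 u hu).false) fun hdeg => hrk ?_
    refine (rk_eq_rk_iff hf).mpr ⟨ld_eq_coe.mpr ⟨?_, hle⟩, hdeg⟩
    exact mem_vars_iff_degreeOf_ne_zero.mpr (hdeg ▸ (degreeOf_pos_of_ld hf).ne')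
  have hcoeff := pseudoCongr_coeffIn_of_pseudoDivisions hS hf h (f.degreeOf u)
  rwa [coeffIn_eq_zero hdeg, ← initial_of_ld hf] at hcoeff

end pseudoCongr

section algRem

variable {Y K : Type*} [Field K] [LinearOrder (Deriv Y)] {S : Set (DiffPoly Y K)}

theorem exists_pseudoDivision_of_not_algReduced {f p : DiffPoly Y K} (hp : p ∈ S)
    (h : ¬ AlgReduced f p) : ∃ g, PseudoDivision S f g := by
  simp only [AlgReduced, not_forall, not_lt] at h
  obtain ⟨u, hu, hle⟩ := h
  obtain ⟨e, q, g, hg, he⟩ := exists_pseudoRem (degreeOf_pos_of_ld hu) f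
  exact ⟨g, p, hp, u, hu, hle, hg, e, q, by rw [initial_of_ld hu, he]⟩

/-- The strict lexicographic order on functions on a linear order, where the entry at the greatest
index at which two functions differ decides. -/
def lexFromTop {ι : Type*} [LinearOrder ι] : (ι → ℕ) → (ι → ℕ) → Prop :=
  Pi.Lex (fun i j => j < i) fun {_} => (· < ·)

theorem wellFounded_lexFromTop {ι : Type*} [LinearOrder ι] [Finite ι] :
    WellFounded (lexFromTop : (ι → ℕ) → (ι → ℕ) → Prop) :=
  Pi.Lex.wellFounded (s := fun _ : ι => (· < · : ℕ → ℕ → Prop)) (fun i j : ι => j < i)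
    fun _ => wellFounded_lt

theorem lexFromTop_of_le_of_lt {ι : Type*} [LinearOrder ι] [Finite ι] {a b : ι → ℕ} {i : ι}
    (hle : ∀ j, i < j → a j ≤ b j) (hlt : a i < b i) : lexFromTop a b := by
  obtain ⟨j, hj, hmax⟩ := Set.exists_max_image {j | a j ≠ b j} id (Set.toFinite _) ⟨i, hlt.ne⟩
  refine ⟨j, fun l hl => by_contra fun hne => (hmax l hne).not_gt hl, ?_⟩
  rcases (hmax i hlt.ne).eq_or_lt with rfl | hij
  · exact hlt
  · exact lt_of_le_of_ne (hle j hij) hj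

theorem finite_setOf_ld_eq_coe (hS : S.Finite) : {u : Deriv Y | ∃ p ∈ S, ld p = u}.Finite :=
  .preimage (f := ((↑) : Deriv Y → WithBot (Deriv Y))) WithBot.coe_injective.injOn (hS.image ld)

theorem wellFounded_pseudoDivision (hS : S.Finite) :
    WellFounded fun g f => PseudoDivision S f g := by
  let L : Set (Deriv Y) := {u | ∃ p ∈ S, ld p = u}
  have : Finite L := finite_setOf_ld_eq_coe hS
  refine Subrelation.wf ?_ (InvImage.wf (fun (f : DiffPoly Y K) (w : L) => f.degreeOf w.1)
    wellFounded_lexFromTop)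
  rintro g f ⟨p, hp, u, hu, hdeg, hg, hrem⟩
  refine lexFromTop_of_le_of_lt (i := ⟨u, p, hp, hu⟩) (fun v hv => ?_) (hg.trans_le hdeg)
  have hstep : PseudoDivision {p} f g := ⟨p, rfl, u, hu, hdeg, hg, hrem⟩
  refine hstep.degreeOf_le ?_
  rintro _ rfl hmem
  exact ((ld_eq_coe.mp hu).2 v hmem).not_gt hv

theorem algRemTerminates_of_finite (hS : S.Finite) (f : DiffPoly Y K) :
    AlgRemTerminates S f := by
  intro g _
  by_contra! h
  obtain ⟨_, ⟨j, rfl⟩, hmin⟩ :=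
    (wellFounded_pseudoDivision hS).has_min (Set.range g) (Set.range_nonempty g)
  exact hmin (g (j + 1)) ⟨j + 1, rfl⟩ (h j)

theorem exists_algRem (hS : S.Finite) (f : DiffPoly Y K) : ∃ g, AlgRem S f g := by
  induction f using (wellFounded_pseudoDivision hS).induction with
  | _ f ih =>
  by_cases h : ∀ p ∈ S, AlgReduced f p
  · exact ⟨f, .refl, h⟩
  · push Not at h
    obtain ⟨p, hp, hred⟩ := h
    obtain ⟨f', hf'⟩ := exists_pseudoDivision_of_not_algReduced hp hred
    obtain ⟨g, hg, hgr⟩ := ih f' hf'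
    exact ⟨g, .head hf' hg, hgr⟩

end algRem

section orders

variable {Y K : Type*} [Field K] {f g : DiffPoly Y K} {v : Y} {N M : ℕ}

/-- The order of `f` in the indeterminate `v` is at most `N`; this holds in particular if `v` does
not occur in `f`. -/
def OrdLE (v : Y) (N : ℕ) (f : DiffPoly Y K) : Prop :=
  ∀ e, (⟨v, e⟩ : Deriv Y) ∈ f.vars → e ≤ N

theorem OrdLE.mono (h : OrdLE v N f) (hNM : N ≤ M) : OrdLE v M f := fun e he => (h e he).trans hNM

theorem ordLE_δ [Differential K] (h : OrdLE v N f) : OrdLE v (N + 1) (δ f) := by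
  intro e he
  rcases mem_vars_δ he with he | ⟨⟨w, l⟩, hw, heq⟩
  · exact (h e he).trans N.le_succ
  · obtain ⟨rfl, rfl⟩ := Deriv.mk.inj heq
    exact Nat.succ_le_succ (h l hw)

theorem ordLE_maxOrd {F : Set (DiffPoly Y K)} (hF : F.Finite) (hf : f ∈ F) (v : Y) :
    OrdLE v (maxOrd v F) f := by
  intro e he
  have hbdd : BddAbove {j | ∃ p ∈ F, (⟨v, j⟩ : Deriv Y) ∈ p.vars} :=
    ((hF.biUnion fun p _ => p.vars.finite_toSet).image Deriv.ord).bddAbove.mono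
      fun _ ⟨_, hp, hj⟩ => Set.mem_image_of_mem Deriv.ord (Set.mem_biUnion hp hj)
  exact le_csSup hbdd ⟨f, hf, he⟩

theorem maxOrd_le {F : Set (DiffPoly Y K)} (h : ∀ f ∈ F, OrdLE v N f) : maxOrd v F ≤ N :=
  csSup_le' fun _ ⟨f, hf, he⟩ => h f hf _ he

variable [LinearOrder (Deriv Y)]

theorem ordLE_of_ld (hR : IsRanking Y) (h : ld f = (⟨v, N⟩ : Deriv Y)) : OrdLE v N f :=
  fun e he => (hR.strictMono_mk v).le_iff_le.mp ((ld_eq_coe.mp h).2 ⟨v, e⟩ he)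

theorem OrdLE.of_pseudoDivisions {S : Set (DiffPoly Y K)} (hf : OrdLE v N f)
    (hS : ∀ p ∈ S, OrdLE v N p) (h : Relation.ReflTransGen (PseudoDivision S) f g) :
    OrdLE v N g := fun e he =>
  (mem_vars_of_pseudoDivisions h he).elim (hf e) fun ⟨p, hp, hep⟩ => hS p hp e hep

theorem Reduced.ordLE (h : Reduced f g) (hg : ld g = (⟨v, N⟩ : Deriv Y)) : OrdLE v N f := by
  intro e he
  by_contra! hlt
  obtain ⟨j, rfl⟩ := Nat.exists_eq_add_of_lt hlt
  exact h.1 _ hg (j + 1) (by omega) he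

theorem reduced_of_algReduced_iterate [Differential K] [CharZero K] (hR : IsRanking Y)
    {u : Deriv Y} (hg : ld g = u)
    (h : ∀ j, u.shift j ∈ f.vars → AlgReduced f (δ^[j] g)) : Reduced f g := by
  constructor
  · intro w hw j hj hmem
    obtain rfl := WithBot.coe_inj.mp (hg.symm.trans hw)
    obtain ⟨l, rfl⟩ := Nat.exists_eq_add_of_le' hj
    have hred := h (l + 1) hmem
    rw [Function.iterate_succ_apply'] at hred
    obtain ⟨hld, hdeg⟩ := rk_eq_coe.mp (rk_δ hR (ld_δ_iterate hR hg l))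
    rw [algReduced_iff_of_ld hld, hdeg, Nat.lt_one_iff] at hred
    exact mem_vars_iff_degreeOf_ne_zero.mp hmem hred
  · by_cases hmem : u ∈ f.vars
    · exact h 0 hmem
    · rw [algReduced_iff_of_ld hg, not_not.mp (mem_vars_iff_degreeOf_ne_zero.not.mp hmem)]
      exact degreeOf_pos_of_ld hg

end orders

section staircase

variable {Y K : Type*} [Field K] {k : ℕ}

/-- The value of `D` after `n i` elements with leading indeterminate `y i` have been computed. -/
def pending (C : Fin k → DiffPoly Y K) (n : Fin k → ℕ) : Set (DiffPoly Y K) :=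
  {f | ∃ i, n i = 0 ∧ f = C i}

/-- The value of `B` after `n i` elements with leading indeterminate `y i` have been computed, where
`b i j` is the one with leader `y_i^(d_i + j)`. -/
def staircase (b : Fin k → ℕ → DiffPoly Y K) (n : Fin k → ℕ) : Set (DiffPoly Y K) :=
  {p | ∃ i j, j < n i ∧ p = b i j}

theorem finite_pending (C : Fin k → DiffPoly Y K) (n : Fin k → ℕ) : (pending C n).Finite :=
  (Set.finite_range C).subset fun _ ⟨i, _, hi⟩ => ⟨i, hi.symm⟩

theorem staircase_zero (b : Fin k → ℕ → DiffPoly Y K) : staircase b 0 = ∅ :=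
  Set.eq_empty_of_forall_notMem fun _ ⟨_, _, hj, _⟩ => Nat.not_lt_zero _ hj

theorem finite_staircase (b : Fin k → ℕ → DiffPoly Y K) (n : Fin k → ℕ) :
    (staircase b n).Finite :=
  (Set.finite_range fun ij : (i : Fin k) × Fin (n i) => b ij.1 ij.2).subset
    fun _ ⟨i, j, hj, hp⟩ => ⟨⟨i, j, hj⟩, hp.symm⟩

variable [LinearOrder (Deriv Y)]

/-- The requirements on the input of the algorithm: a ranking, and a family `C` of polynomials with
leaders `y_i^(d_i)`, for distinct `y_i`, whose order in `y_i` is at most `m_i`. -/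
structure IsInput (C : Fin k → DiffPoly Y K) (y : Fin k → Y) (d m : Fin k → ℕ) : Prop where
  ranking : IsRanking Y
  ld_eq : ∀ i, ld (C i) = (⟨y i, d i⟩ : Deriv Y)
  injective : Function.Injective y
  ordLE : ∀ i t, OrdLE (y t) (m t) (C i)

variable {C : Fin k → DiffPoly Y K} {y : Fin k → Y} {d m : Fin k → ℕ}

theorem IsInput.le (hI : IsInput C y d m) (i : Fin k) : d i ≤ m i :=
  hI.ordLE i i (d i) (ld_eq_coe.mp (hI.ld_eq i)).1

theorem IsInput.mk_inj (hI : IsInput C y d m) {i t : Fin k} {e l : ℕ} :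
    ((⟨y i, e⟩ : Deriv Y) : WithBot (Deriv Y)) = (⟨y t, l⟩ : Deriv Y) ↔ i = t ∧ e = l := by
  rw [WithBot.coe_inj, Deriv.mk.injEq, hI.injective.eq_iff]

theorem WeakDTriangular.injective_of_ld_eq (hC : WeakDTriangular (Set.range C))
    (hCinj : Function.Injective C) (hld : ∀ i, ld (C i) = (⟨y i, d i⟩ : Deriv Y)) :
    Function.Injective y := fun i t hit =>
  hCinj <| hC.2 ⟨i, rfl⟩ ⟨t, rfl⟩ <| by rw [lv_of_ld (hld i), lv_of_ld (hld t), hit]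

variable [Differential K]

theorem finite_candidates {D B : Set (DiffPoly Y K)} (hD : D.Finite) (hB : B.Finite) :
    (candidates y m D B).Finite :=
  hD.union (((hB.subset (Set.sep_subset _ _)).image δ).subset (Set.sep_subset _ _))

theorem finite_reducers {B : Set (DiffPoly Y K)} (D : Set (DiffPoly Y K)) (hB : B.Finite)
    (f : DiffPoly Y K) : (reducers D B f).Finite := by
  rw [reducers]
  split_ifs
  · exact hB
  · exact hB.union (((hB.subset (Set.sep_subset _ _)).image δ).subset Set.sdiff_subset)

/-- The candidate with leading indeterminate `y i` after `n i` elements with that leading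
indeterminate have been computed. -/
def candidate (C : Fin k → DiffPoly Y K) (b : Fin k → ℕ → DiffPoly Y K) (n : Fin k → ℕ)
    (i : Fin k) : DiffPoly Y K :=
  if n i = 0 then C i else δ (b i (n i - 1))

/-- The set w.r.t. which the candidate with leading indeterminate `y i` is reduced. -/
abbrev candidateReducers (C : Fin k → DiffPoly Y K) (b : Fin k → ℕ → DiffPoly Y K) (n : Fin k → ℕ)
    (i : Fin k) : Set (DiffPoly Y K) :=
  reducers (pending C n) (staircase b n) (candidate C b n i)

/-- The part of the loop invariant that concerns ranks and reducedness: for each `i`, the first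
`n i` of the elements `B_i^j` of the output have been computed, and they are the `b i j`. -/
structure IsStaircase (C : Fin k → DiffPoly Y K) (d m : Fin k → ℕ) (b : Fin k → ℕ → DiffPoly Y K)
    (n : Fin k → ℕ) : Prop where
  le : ∀ i, n i ≤ m i - d i + 1
  rk_eq : ∀ i j, j < n i → rk (b i j) = rk (δ^[j] (C i))
  reduced : ∀ i j, j < n i → ∀ t, t ≠ i → Reduced (b i j) (C t)

variable {b : Fin k → ℕ → DiffPoly Y K} {n : Fin k → ℕ} {f g p : DiffPoly Y K}
  [CharZero K]

namespace IsStaircase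

variable (hI : IsInput C y d m) (hB : IsStaircase C d m b n)

include hI hB

theorem ld_eq {i : Fin k} {j : ℕ} (hj : j < n i) : ld (b i j) = (⟨y i, d i + j⟩ : Deriv Y) :=
  have hld := ld_δ_iterate hI.ranking (hI.ld_eq i) j
  ((rk_eq_rk_iff hld).mp (hB.rk_eq i j hj)).1

theorem lv_eq_lv_iff {i t : Fin k} {j l : ℕ} (hj : j < n i) (hl : l < n t) :
    lv (b i j) = lv (b t l) ↔ i = t := by
  rw [lv_of_ld (hB.ld_eq hI hj), lv_of_ld (hB.ld_eq hI hl), WithBot.coe_inj,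
    hI.injective.eq_iff]

theorem rk_le_rk_iff {i : Fin k} {j l : ℕ} (hj : j < n i) (hl : l < n i) :
    rk (b i j) ≤ rk (b i l) ↔ j ≤ l := by
  have hmono := hI.ranking.strictMono_mk (y i)
  refine ⟨fun h => ?_, fun h => ?_⟩
  · have := hmono.le_iff_le.mp (le_of_rk_le (hB.ld_eq hI hj) (hB.ld_eq hI hl) h)
    omega
  · rcases h.eq_or_lt with rfl | h
    · exact le_rfl
    · exact (rk_lt_of_lt (hB.ld_eq hI hj) (hB.ld_eq hI hl) (hmono (by omega))).le

theorem lowest_eq : lowest (staircase b n) = {p | ∃ i, 0 < n i ∧ p = b i 0} := by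
  ext p
  constructor
  · rintro ⟨⟨i, j, hj, rfl⟩, hmin⟩
    have hi : 0 < n i := by omega
    have hle := hmin _ ⟨i, 0, hi, rfl⟩ ((hB.lv_eq_lv_iff hI hi hj).mpr rfl)
    obtain rfl := Nat.le_zero.mp ((hB.rk_le_rk_iff hI hj hi).mp hle)
    exact ⟨i, hi, rfl⟩
  · rintro ⟨i, hi, rfl⟩
    refine ⟨⟨i, 0, hi, rfl⟩, ?_⟩
    rintro _ ⟨t, l, hl, rfl⟩ hlv
    obtain rfl := (hB.lv_eq_lv_iff hI hl hi).mp hlv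
    exact (hB.rk_le_rk_iff hI hi hl).mpr l.zero_le

theorem highest_eq : highest (staircase b n) = {p | ∃ i, 0 < n i ∧ p = b i (n i - 1)} := by
  ext p
  constructor
  · rintro ⟨⟨i, j, hj, rfl⟩, hmax⟩
    have hi : n i - 1 < n i := by omega
    have hle := hmax _ ⟨i, n i - 1, hi, rfl⟩ ((hB.lv_eq_lv_iff hI hi hj).mpr rfl)
    have hji := (hB.rk_le_rk_iff hI hi hj).mp hle
    exact ⟨i, by omega, by rw [show j = n i - 1 by omega]⟩
  · rintro ⟨i, hi, rfl⟩
    have hlast : n i - 1 < n i := by omega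
    refine ⟨⟨i, n i - 1, hlast, rfl⟩, ?_⟩
    rintro _ ⟨t, l, hl, rfl⟩ hlv
    obtain rfl := (hB.lv_eq_lv_iff hI hl hlast).mp hlv
    exact (hB.rk_le_rk_iff hI hl hlast).mpr (by omega)

theorem rk_candidate (i : Fin k) : rk (candidate C b n i) = rk (δ^[n i] (C i)) := by
  rw [candidate]
  split_ifs with hi
  · rw [hi, Function.iterate_zero_apply]
  · obtain ⟨j, hj⟩ := Nat.exists_eq_succ_of_ne_zero hi
    have hrk := hB.rk_eq i j (by omega)
    rw [hj, Function.iterate_succ_apply', Nat.succ_sub_one]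
    exact rk_δ_congr hI.ranking (ld_δ_iterate hI.ranking (hI.ld_eq i) j) hrk

theorem ld_candidate (i : Fin k) : ld (candidate C b n i) = (⟨y i, d i + n i⟩ : Deriv Y) :=
  have hld := ld_δ_iterate hI.ranking (hI.ld_eq i) (n i)
  ((rk_eq_rk_iff hld).mp (hB.rk_candidate hI i)).1

theorem candidate_mem_pending_iff (i : Fin k) : candidate C b n i ∈ pending C n ↔ n i = 0 := by
  refine ⟨fun ⟨t, ht, heq⟩ => ?_, fun hi => ⟨i, hi, if_pos hi⟩⟩
  have hld := hB.ld_candidate hI i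
  rw [heq, hI.ld_eq, hI.mk_inj] at hld
  exact hld.1 ▸ ht

theorem candidates_eq : candidates y m (pending C n) (staircase b n) =
    {f | ∃ i, n i ≤ m i - d i ∧ f = candidate C b n i} := by
  ext f
  rw [candidates, hB.highest_eq hI]
  constructor
  · rintro (⟨i, hi, rfl⟩ | ⟨⟨_, ⟨i, hi, rfl⟩, rfl⟩, hbound⟩)
    · exact ⟨i, by omega, (if_pos hi).symm⟩
    · have hcand : candidate C b n i = δ (b i (n i - 1)) := if_neg hi.ne'
      rw [← hcand] at hbound ⊢
      have hle := hbound i _ (hB.ld_candidate hI i)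
      exact ⟨i, by omega, rfl⟩
  · rintro ⟨i, hi, rfl⟩
    by_cases h0 : n i = 0
    · exact Or.inl ((hB.candidate_mem_pending_iff hI i).mpr h0)
    · refine Or.inr ⟨⟨_, ⟨i, Nat.pos_of_ne_zero h0, rfl⟩, (if_neg h0).symm⟩, fun t e he => ?_⟩
      rw [hB.ld_candidate hI, hI.mk_inj] at he
      obtain ⟨rfl, rfl⟩ := he
      have := hI.le i
      omega

theorem mem_candidateReducers {i : Fin k} :
    p ∈ candidateReducers C b n i ↔
      p ∈ staircase b n ∨ 0 < n i ∧ ∃ t, 0 < n t ∧ p = δ (b t 0) ∧ p ≠ candidate C b n i := by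
  rw [candidateReducers, reducers, hB.candidate_mem_pending_iff hI, hB.lowest_eq hI]
  split_ifs with hi
  · simp [hi]
  · rw [Set.mem_union, Set.mem_sdiff, Set.mem_image, Set.mem_singleton_iff,
      and_iff_right (Nat.pos_of_ne_zero hi)]
    constructor
    · rintro (hp | ⟨⟨_, ⟨t, ht, rfl⟩, rfl⟩, hne⟩)
      exacts [Or.inl hp, Or.inr ⟨t, ht, rfl, hne⟩]
    · rintro (hp | ⟨t, ht, rfl, hne⟩)
      exacts [Or.inl hp, Or.inr ⟨⟨_, ⟨t, ht, rfl⟩, rfl⟩, hne⟩]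

theorem ld_ne_of_mem_candidateReducers {i : Fin k} (hp : p ∈ candidateReducers C b n i) :
    ld p ≠ (⟨y i, d i + n i⟩ : Deriv Y) := by
  intro hld
  rcases (hB.mem_candidateReducers hI).mp hp with ⟨t, j, hj, rfl⟩ | ⟨hi, t, ht, rfl, hne⟩
  · rw [hB.ld_eq hI hj, hI.mk_inj] at hld
    obtain ⟨rfl, hjn⟩ := hld
    omega
  · rw [ld_δ hI.ranking (hB.ld_eq hI ht), Deriv.shift, hI.mk_inj] at hld
    obtain ⟨rfl, hn⟩ := hld
    exact hne (by rw [candidate, if_neg hi.ne', show n t - 1 = 0 by simp only at hn; omega])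

theorem lt_of_isMinRank {u : Deriv Y}
    (hf : IsMinRank (candidates y m (pending C n) (staircase b n)) f) (hu : ld f = u)
    {t : Fin k} {j : ℕ} (hlt : (⟨y t, d t + j⟩ : Deriv Y) < u) (hj : d t + j ≤ m t) :
    j < n t := by
  by_contra! hle
  have hcand : candidate C b n t ∈ candidates y m (pending C n) (staircase b n) := by
    rw [hB.candidates_eq hI]
    exact ⟨t, by omega, rfl⟩
  have hle' := le_of_rk_le hu (hB.ld_candidate hI t) (hf.2 _ hcand)
  exact (hle'.trans ((hI.ranking.strictMono_mk (y t)).monotone (by omega))).not_gt hlt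

theorem ordLE_add {i : Fin k} {j : ℕ} (hj : j < n i) (t : Fin k) :
    OrdLE (y t) (d t + j) (b i j) := by
  rcases eq_or_ne t i with rfl | hti
  · exact ordLE_of_ld hI.ranking (hB.ld_eq hI hj)
  · exact ((hB.reduced i j hj t hti).ordLE (hI.ld_eq t)).mono (Nat.le_add_right _ _)

theorem ordLE {i : Fin k} {j : ℕ} (hj : j < n i) (t : Fin k) : OrdLE (y t) (m t) (b i j) := by
  rcases eq_or_ne t i with rfl | hti
  · refine (hB.ordLE_add hI hj t).mono ?_
    have := hB.le t
    have := hI.le t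
    omega
  · exact ((hB.reduced i j hj t hti).ordLE (hI.ld_eq t)).mono (hI.le t)

theorem ordLE_of_pseudoDivisions {i t : Fin k} (hti : t ≠ i)
    (hg : Relation.ReflTransGen
      (PseudoDivision (candidateReducers C b n i)) (candidate C b n i) g) :
    OrdLE (y t) (if n i = 0 then m t else max (m t) (d t + 1)) g := by
  refine OrdLE.of_pseudoDivisions ?_ (fun p hp => ?_) hg
  · rw [candidate]
    split_ifs with hi
    · exact hI.ordLE i t
    · have hred := hB.reduced i (n i - 1) (by omega) t hti
      exact (ordLE_δ (hred.ordLE (hI.ld_eq t))).mono (le_max_right _ _)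
  · rcases (hB.mem_candidateReducers hI).mp hp with ⟨s, j, hj, rfl⟩ | ⟨hi, s, hs, rfl, -⟩
    · exact (hB.ordLE hI hj t).mono (by split_ifs <;> simp)
    · rw [if_neg hi.ne']
      exact (ordLE_δ (hB.ordLE_add hI hs t)).mono (le_max_right _ _)

theorem exists_reducer {i t : Fin k} (hti : t ≠ i)
    (hmin : IsMinRank (candidates y m (pending C n) (staircase b n)) (candidate C b n i)) {j : ℕ}
    (hlt : (⟨y t, d t + j⟩ : Deriv Y) < ⟨y i, d i + n i⟩)
    (hj : d t + j ≤ if n i = 0 then m t else max (m t) (d t + 1)) :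
    ∃ p ∈ candidateReducers C b n i, rk p = rk (δ^[j] (C t)) := by
  by_cases hm : d t + j ≤ m t
  · have hjn := hB.lt_of_isMinRank hI hmin (hB.ld_candidate hI i) hlt hm
    exact ⟨b t j, (hB.mem_candidateReducers hI).mpr (Or.inl ⟨t, j, hjn, rfl⟩), hB.rk_eq t j hjn⟩
  · obtain ⟨hi, rfl⟩ : 0 < n i ∧ j = 1 := by
      have := hI.le t
      split_ifs at hj <;> omega
    have hlt0 := (hI.ranking.strictMono_mk (y t) (Nat.lt_succ_self (d t))).trans hlt
    have ht : 0 < n t := hB.lt_of_isMinRank hI hmin (hB.ld_candidate hI i) hlt0 (hI.le t)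
    have hne : δ (b t 0) ≠ candidate C b n i := fun h => hti <| by
      have hld := ld_δ hI.ranking (hB.ld_eq hI ht)
      rw [h, hB.ld_candidate hI, Deriv.shift, hI.mk_inj] at hld
      exact hld.1.symm
    refine ⟨δ (b t 0), (hB.mem_candidateReducers hI).mpr (Or.inr ⟨hi, t, ht, rfl, hne⟩), ?_⟩
    exact rk_δ_congr hI.ranking (hI.ld_eq t) (hB.rk_eq t 0 ht)

theorem reduced_of_algRem {i t : Fin k} (hti : t ≠ i)
    (hmin : IsMinRank (candidates y m (pending C n) (staircase b n)) (candidate C b n i))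
    (hrem : AlgRem (candidateReducers C b n i) (candidate C b n i) g) :
    Reduced g (C t) := by
  have hle : ∀ v ∈ g.vars, v ≤ ⟨y i, d i + n i⟩ :=
    (restrict_pseudoDivisions hrem.1 (fun p hp => hB.ld_ne_of_mem_candidateReducers hI hp)
      (ld_eq_coe.mp (hB.ld_candidate hI i)).2).2
  refine reduced_of_algReduced_iterate hI.ranking (hI.ld_eq t) fun j hj => ?_
  have hlt : (⟨y t, d t + j⟩ : Deriv Y) < ⟨y i, d i + n i⟩ :=
    lt_of_le_of_ne (hle _ hj) fun h => hti (hI.mk_inj.mp (WithBot.coe_inj.mpr h)).1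
  obtain ⟨p, hp, hrk⟩ := hB.exists_reducer hI hti hmin hlt
    (hB.ordLE_of_pseudoDivisions hI hti hrem.1 _ hj)
  exact (hrem.2 p hp).of_rk_eq (ld_δ_iterate hI.ranking (hI.ld_eq t) j) hrk

end IsStaircase

end staircase

section extend

variable {Y K : Type*} [Field K] {k : ℕ}

/-- The family `b` with `g` as its element of index `(i, n i)`; this is how `b` changes when `g` is
added to `staircase b n`. -/
def extend (b : Fin k → ℕ → DiffPoly Y K) (n : Fin k → ℕ) (i : Fin k) (g : DiffPoly Y K) :
    Fin k → ℕ → DiffPoly Y K :=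
  Function.update b i (Function.update (b i) (n i) g)

variable {b : Fin k → ℕ → DiffPoly Y K} {n : Fin k → ℕ} {i : Fin k} {g : DiffPoly Y K}

theorem lt_add_single_iff {t : Fin k} {j : ℕ} :
    j < (n + Pi.single i 1 : Fin k → ℕ) t ↔ j < n t ∨ t = i ∧ j = n t := by
  rcases eq_or_ne t i with rfl | hti
  · rw [Pi.add_apply, Pi.single_eq_same, Nat.lt_succ_iff_lt_or_eq, and_iff_right rfl]
  · simp [hti]

theorem extend_self : extend b n i g i (n i) = g := by
  rw [extend, Function.update_self, Function.update_self]

theorem extend_of_lt {t : Fin k} {j : ℕ} (hj : j < n t) : extend b n i g t j = b t j := by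
  rcases eq_or_ne t i with rfl | hti
  · rw [extend, Function.update_self, Function.update_of_ne hj.ne]
  · rw [extend, Function.update_of_ne hti]

theorem forall_extend {P : Fin k → ℕ → DiffPoly Y K → Prop}
    (hb : ∀ t j, j < n t → P t j (b t j)) (hg : P i (n i) g) (t : Fin k) (j : ℕ)
    (hj : j < (n + Pi.single i 1 : Fin k → ℕ) t) : P t j (extend b n i g t j) := by
  rcases lt_add_single_iff.mp hj with hj | ⟨rfl, rfl⟩
  · rw [extend_of_lt hj]
    exact hb t j hj
  · rw [extend_self]
    exact hg

theorem staircase_extend :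
    staircase (extend b n i g) (n + Pi.single i 1) = staircase b n ∪ {g} := by
  ext p
  constructor
  · rintro ⟨t, j, hj, rfl⟩
    exact forall_extend (P := fun _ _ (p : DiffPoly Y K) => p ∈ staircase b n ∪ {g})
      (fun t j hj => Or.inl ⟨t, j, hj, rfl⟩) (Or.inr rfl) t j hj
  · rintro (⟨t, j, hj, rfl⟩ | rfl)
    · exact ⟨t, j, lt_add_single_iff.mpr (Or.inl hj), (extend_of_lt hj).symm⟩
    · exact ⟨i, n i, lt_add_single_iff.mpr (Or.inr ⟨rfl, rfl⟩), extend_self.symm⟩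

variable [LinearOrder (Deriv Y)] [Differential K] {C : Fin k → DiffPoly Y K}
  {y : Fin k → Y} {d m : Fin k → ℕ}

theorem IsStaircase.extend_of_rk_eq (hB : IsStaircase C d m b n) (hi : n i ≤ m i - d i)
    (hrk : rk g = rk (δ^[n i] (C i))) (hred : ∀ t, t ≠ i → Reduced g (C t)) :
    IsStaircase C d m (extend b n i g) (n + Pi.single i 1) where
  le t := by
    rcases eq_or_ne t i with rfl | hti
    · simpa using hi
    · simpa [hti] using hB.le t
  rk_eq := forall_extend (P := fun t j p => rk p = rk (δ^[j] (C t))) hB.rk_eq hrk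
  reduced := forall_extend (P := fun i _ p => ∀ t, t ≠ i → Reduced p (C t)) hB.reduced hred

variable [CharZero K]

theorem IsInput.pending_add_single (hI : IsInput C y d m) (hB : IsStaircase C d m b n) :
    pending C (n + Pi.single i 1) = pending C n \ {candidate C b n i} := by
  ext f
  constructor
  · rintro ⟨t, ht, rfl⟩
    have hti : t ≠ i := by rintro rfl; simp at ht
    refine ⟨⟨t, by simpa [hti] using ht, rfl⟩, fun heq => hti ?_⟩
    have hld := hI.ld_eq t
    rw [Set.mem_singleton_iff.mp heq, hB.ld_candidate hI, hI.mk_inj] at hld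
    exact hld.1.symm
  · rintro ⟨⟨t, ht, rfl⟩, hne⟩
    have hti : t ≠ i := by rintro rfl; exact hne (if_pos ht).symm
    exact ⟨t, by simpa [hti] using ht, rfl⟩

theorem IsStaircase.lowest_subset_extend (hI : IsInput C y d m) (hB : IsStaircase C d m b n)
    (hB' : IsStaircase C d m (extend b n i g) (n + Pi.single i 1)) :
    lowest (staircase b n) ⊆ lowest (staircase b n ∪ {g}) := by
  rw [← staircase_extend, hB.lowest_eq hI, hB'.lowest_eq hI]
  rintro _ ⟨t, ht, rfl⟩
  exact ⟨t, lt_add_single_iff.mpr (Or.inl ht), (extend_of_lt ht).symm⟩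

end extend

section invariant

variable {Y K : Type*} [Field K] [LinearOrder (Deriv Y)]

theorem initSep_union (F G : Set (DiffPoly Y K)) : initSep (F ∪ G) = initSep F ∪ initSep G := by
  rw [initSep, Set.image_union, Set.image_union, Set.union_union_union_comm, initSep, initSep]

theorem initSep_singleton_subset {A : Set (DiffPoly Y K)} {f : DiffPoly Y K} :
    initSep {f} ⊆ A ↔ initial f ∈ A ∧ separant f ∈ A := by
  rw [initSep, Set.union_subset_iff, Set.image_singleton, Set.image_singleton,
    Set.singleton_subset_iff, Set.singleton_subset_iff]

variable [Differential K] {k : ℕ}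

/-- The loop invariant. Once `B` contains an element with leading indeterminate `y i`, it generates
`C i`, and the initial and separant of `C i`, up to saturation. -/
structure Invariant (C : Fin k → DiffPoly Y K) (y : Fin k → Y) (d m : Fin k → ℕ)
    (b : Fin k → ℕ → DiffPoly Y K) (n : Fin k → ℕ) : Prop extends IsStaircase C d m b n where
  ordLE_of_notMem : ∀ i j, j < n i → ∀ v, v ∉ Set.range y →
    OrdLE v (maxOrd v (Set.range C) + ∑ t, (n t - 1)) (b i j)
  staircase_subset_diffIdeal_lowest : staircase b n ⊆ diffIdeal (lowest (staircase b n))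
  staircase_subset_diffIdeal : staircase b n ⊆ diffIdeal (Set.range C)
  initSep_subset :
    initSep (staircase b n) ⊆ powersMod (initSep (Set.range C)) (diffIdeal (Set.range C))
  mem_saturation : ∀ i, 0 < n i →
    C i ∈ saturation (diffIdeal (staircase b n)) (initSep (staircase b n))
  initSep_subset_saturation : ∀ i, 0 < n i → initSep {C i} ⊆
    saturation (powersMod (initSep (staircase b n)) (diffIdeal (staircase b n)))
      (initSep (staircase b n))

variable {C : Fin k → DiffPoly Y K} {y : Fin k → Y} {d m : Fin k → ℕ}
  {b : Fin k → ℕ → DiffPoly Y K} {n : Fin k → ℕ} {i : Fin k} {f g p : DiffPoly Y K}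

theorem invariant_zero (C : Fin k → DiffPoly Y K) (y : Fin k → Y) (d m : Fin k → ℕ)
    (b : Fin k → ℕ → DiffPoly Y K) : Invariant C y d m b 0 := by
  refine ⟨⟨fun _ => Nat.zero_le _, ?_, ?_⟩, ?_, ?_, ?_, ?_, ?_, ?_⟩ <;>
    simp [staircase_zero, initSep]

namespace Invariant

theorem diffIdeal_lowest_le (hV : Invariant C y d m b n) :
    diffIdeal (lowest (staircase b n)) ≤ diffIdeal (Set.range C) :=
  diffIdeal_le_diffIdeal ((Set.sep_subset _ _).trans hV.staircase_subset_diffIdeal)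

theorem candidate_mem_diffIdeal (hV : Invariant C y d m b n) (i : Fin k) :
    candidate C b n i ∈ diffIdeal (Set.range C) := by
  rw [candidate]
  split_ifs with hi
  · exact subset_diffIdeal _ ⟨i, rfl⟩
  · exact δ_mem_diffIdeal (hV.staircase_subset_diffIdeal ⟨i, n i - 1, by omega, rfl⟩)

variable [CharZero K] (hI : IsInput C y d m) (hV : Invariant C y d m b n)

include hI hV

theorem initSep_δ_subset {j : ℕ} (hj : j < n i) :
    initSep {δ (b i j)} ⊆ powersMod (initSep (Set.range C)) (diffIdeal (Set.range C)) := by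
  have hmem := hV.initSep_subset (separant_mem_initSep ⟨i, j, hj, rfl⟩)
  have hld := hV.ld_eq hI hj
  rw [initSep_singleton_subset, initial_δ hI.ranking hld, separant_δ hI.ranking hld]
  exact ⟨hmem, hmem⟩

theorem initSep_candidate_subset (i : Fin k) :
    initSep {candidate C b n i} ⊆
      powersMod (initSep (Set.range C)) (diffIdeal (Set.range C)) := by
  rw [candidate]
  split_ifs with hi
  · exact (initSep_mono (Set.singleton_subset_iff.mpr (Set.mem_range_self i))).trans
      (Submonoid.subset_closure.trans (powers_subset_powersMod _ _))
  · exact hV.initSep_δ_subset hI (by omega)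

theorem candidateReducers_subset (i : Fin k) :
    candidateReducers C b n i ⊆ diffIdeal (lowest (staircase b n)) := by
  intro p hp
  rcases (hV.mem_candidateReducers hI).mp hp with hp | ⟨-, t, ht, rfl, -⟩
  · exact hV.staircase_subset_diffIdeal_lowest hp
  · exact δ_mem_diffIdeal (hV.staircase_subset_diffIdeal_lowest ⟨t, 0, ht, rfl⟩)

theorem candidateReducers_subset_diffIdeal (i : Fin k) :
    candidateReducers C b n i ⊆ diffIdeal (Set.range C) :=
  (hV.candidateReducers_subset hI i).trans hV.diffIdeal_lowest_le

theorem initial_candidateReducers_subset (i : Fin k) :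
    initial '' candidateReducers C b n i ⊆
      powersMod (initSep (Set.range C)) (diffIdeal (Set.range C)) := by
  rintro _ ⟨p, hp, rfl⟩
  rcases (hV.mem_candidateReducers hI).mp hp with hp | ⟨-, t, ht, rfl, -⟩
  · exact hV.initSep_subset (initial_mem_initSep hp)
  · exact (initSep_singleton_subset.mp (hV.initSep_δ_subset hI ht)).1

theorem saturation_eq_univ_of_rk_ne
    (hrem : AlgRem (candidateReducers C b n i) (candidate C b n i) g)
    (hrk : rk g ≠ rk (candidate C b n i)) :
    saturation (diffIdeal (Set.range C)) (initSep (Set.range C)) = Set.univ := by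
  have hcongr := pseudoCongr_initial_zero_of_rk_ne
    (fun p hp => hV.ld_ne_of_mem_candidateReducers hI hp) (hV.ld_candidate hI i) hrem.1 hrk
  exact saturation_eq_univ <| hcongr.mem_powersMod (hV.candidateReducers_subset_diffIdeal hI i)
    (hV.initial_candidateReducers_subset hI i)
    (initSep_singleton_subset.mp (hV.initSep_candidate_subset hI i)).1

theorem mem_diffIdeal_of_algRem
    (hrem : AlgRem (candidateReducers C b n i) (candidate C b n i) g) :
    g ∈ diffIdeal (Set.range C) :=
  (pseudoCongr_of_pseudoDivisions hrem.1).mem_ideal (hV.candidateReducers_subset_diffIdeal hI i)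
    (hV.candidate_mem_diffIdeal i)

theorem initSep_subset_of_algRem
    (hrem : AlgRem (candidateReducers C b n i) (candidate C b n i) g)
    (hrk : rk g = rk (candidate C b n i)) :
    initSep {g} ⊆ powersMod (initSep (Set.range C)) (diffIdeal (Set.range C)) := by
  have hS := fun p hp => hV.ld_ne_of_mem_candidateReducers hI (p := p) (i := i) hp
  have hld := hV.ld_candidate hI i
  have hmem := initSep_singleton_subset.mp (hV.initSep_candidate_subset hI i)
  have hideal := hV.candidateReducers_subset_diffIdeal hI i
  have hinitial := hV.initial_candidateReducers_subset hI i
  exact initSep_singleton_subset.mpr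
    ⟨(pseudoCongr_initial_of_rk_eq hS hld hrem.1 hrk).mem_powersMod hideal hinitial hmem.1,
      (pseudoCongr_separant_of_rk_eq hS hld hrem.1 hrk).mem_powersMod hideal hinitial hmem.2⟩

theorem mem_diffIdeal_lowest_of_algRem
    (hrem : AlgRem (candidateReducers C b n i) (candidate C b n i) g)
    (hB' : IsStaircase C d m (extend b n i g) (n + Pi.single i 1)) :
    g ∈ diffIdeal (lowest (staircase b n ∪ {g})) := by
  by_cases hi : n i = 0
  · refine subset_diffIdeal _ ?_
    rw [← staircase_extend, hB'.lowest_eq hI]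
    exact ⟨i, by simp, by rw [← hi, extend_self]⟩
  · refine diffIdeal_mono (hV.lowest_subset_extend hI hB') ?_
    refine (pseudoCongr_of_pseudoDivisions hrem.1).mem_ideal (hV.candidateReducers_subset hI i) ?_
    rw [candidate, if_neg hi]
    exact δ_mem_diffIdeal (hV.staircase_subset_diffIdeal_lowest ⟨i, n i - 1, by omega, rfl⟩)

end Invariant

end invariant

section update

variable {Y K : Type*} [Field K] [LinearOrder (Deriv Y)] [Differential K] [CharZero K] {k : ℕ}
  {C : Fin k → DiffPoly Y K} {y : Fin k → Y} {d m : Fin k → ℕ}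
  {b : Fin k → ℕ → DiffPoly Y K} {n : Fin k → ℕ} {i : Fin k} {g : DiffPoly Y K}

theorem sum_sub_one_add_single (hi : 0 < n i) :
    ∑ t, ((n + Pi.single i 1 : Fin k → ℕ) t - 1) = ∑ t, (n t - 1) + 1 := by
  have hterm : ∀ t, (n + Pi.single i 1 : Fin k → ℕ) t - 1 =
      (n t - 1) + (Pi.single i 1 : Fin k → ℕ) t := by
    intro t
    rcases eq_or_ne t i with rfl | hti
    · rw [Pi.add_apply, Pi.single_eq_same]
      omega
    · rw [Pi.add_apply, Pi.single_eq_of_ne hti, add_zero, add_zero]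
  rw [Finset.sum_congr rfl fun t _ => hterm t, Finset.sum_add_distrib,
    Finset.sum_pi_single', if_pos (Finset.mem_univ i)]

theorem sum_sub_one_le_add_single (n : Fin k → ℕ) (i : Fin k) :
    ∑ t, (n t - 1) ≤ ∑ t, ((n + Pi.single i 1 : Fin k → ℕ) t - 1) :=
  Finset.sum_le_sum fun _ _ => Nat.sub_le_sub_right (Nat.le_add_right _ _) 1

namespace IsStaircase

variable (hI : IsInput C y d m) (hB : IsStaircase C d m b n)

include hI hB

theorem candidateReducers_eq (hi : n i = 0) : candidateReducers C b n i = staircase b n :=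
  if_pos ((hB.candidate_mem_pending_iff hI i).mpr hi)

theorem mem_saturation_of_algRem (hi : n i = 0)
    (hrem : AlgRem (candidateReducers C b n i) (candidate C b n i) g) :
    C i ∈ saturation (diffIdeal (staircase b n ∪ {g})) (initSep (staircase b n ∪ {g})) := by
  rw [hB.candidateReducers_eq hI hi, candidate, if_pos hi] at hrem
  have hS := Set.subset_union_left (s := staircase b n) (t := {g})
  have hspan := Ideal.span_le.mpr (hS.trans (subset_diffIdeal (staircase b n ∪ {g})))
  exact (pseudoCongr_of_pseudoDivisions hrem.1).mem_saturation
    (Set.subset_union_left.trans (initSep_mono hS))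
    (fun _ hc _ hbc => ((diffIdeal _).sub_mem_iff_left hc).mp (hspan hbc))
    (subset_diffIdeal _ (Or.inr rfl))

theorem initSep_subset_saturation_of_algRem (hi : n i = 0)
    (hrem : AlgRem (candidateReducers C b n i) (candidate C b n i) g)
    (hrk : rk g = rk (candidate C b n i)) :
    initSep {C i} ⊆
      saturation (powersMod (initSep (staircase b n ∪ {g})) (diffIdeal (staircase b n ∪ {g})))
        (initSep (staircase b n ∪ {g})) := by
  have hne := fun p hp => hB.ld_ne_of_mem_candidateReducers hI (p := p) (i := i) hp
  have hld := hB.ld_candidate hI i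
  rw [hB.candidateReducers_eq hI hi] at hrem hne
  rw [candidate, if_pos hi] at hrem hrk hld
  have hS := Set.subset_union_left (s := staircase b n) (t := {g})
  have hspan := Ideal.span_le.mpr (hS.trans (subset_diffIdeal (staircase b n ∪ {g})))
  have hg := (Set.subset_union_right (s := staircase b n) (t := {g})) rfl
  have hsat : ∀ {x z}, PseudoCongr (staircase b n) x z → z ∈ initSep (staircase b n ∪ {g}) →
      x ∈ saturation (powersMod (initSep (staircase b n ∪ {g}))
        (diffIdeal (staircase b n ∪ {g}))) (initSep (staircase b n ∪ {g})) := fun hxz hz =>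
    hxz.mem_saturation (Set.subset_union_left.trans (initSep_mono hS))
      (fun _ hc _ hbc => (mem_powersMod_congr (hspan hbc)).mpr hc)
      (powers_subset_powersMod _ _ (Submonoid.subset_closure hz))
  exact initSep_singleton_subset.mpr
    ⟨hsat (pseudoCongr_initial_of_rk_eq hne hld hrem.1 hrk) (initial_mem_initSep hg),
      hsat (pseudoCongr_separant_of_rk_eq hne hld hrem.1 hrk) (separant_mem_initSep hg)⟩

end IsStaircase

namespace Invariant

variable (hI : IsInput C y d m) (hV : Invariant C y d m b n)

include hI hV

/- Orders in the non-leading indeterminates grow by one in a differentiation, and do not grow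
otherwise. -/
theorem ordLE_of_algRem (hrem : AlgRem (candidateReducers C b n i) (candidate C b n i) g) {v : Y}
    (hv : v ∉ Set.range y) :
    OrdLE v (maxOrd v (Set.range C) + ∑ t, ((n + Pi.single i 1 : Fin k → ℕ) t - 1)) g := by
  have hmono := Nat.add_le_add_left (sum_sub_one_le_add_single n i) (maxOrd v (Set.range C))
  have hδ : 0 < n i → ∀ {t j}, j < n t →
      OrdLE v (maxOrd v (Set.range C) + ∑ t, ((n + Pi.single i 1 : Fin k → ℕ) t - 1))
        (δ (b t j)) := fun hi t j hj => by
    rw [sum_sub_one_add_single hi, ← add_assoc]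
    exact ordLE_δ (hV.ordLE_of_notMem t j hj v hv)
  refine OrdLE.of_pseudoDivisions ?_ (fun p hp => ?_) hrem.1
  · rw [candidate]
    split_ifs with hi
    · exact (ordLE_maxOrd (Set.finite_range C) ⟨i, rfl⟩ v).mono (Nat.le_add_right _ _)
    · exact hδ (by omega) (by omega)
  · rcases (hV.mem_candidateReducers hI).mp hp with ⟨t, j, hj, rfl⟩ | ⟨hi, t, ht, rfl, -⟩
    · exact (hV.ordLE_of_notMem t j hj v hv).mono hmono
    · exact hδ hi ht

theorem extend_of_algRem
    (hmin : IsMinRank (candidates y m (pending C n) (staircase b n)) (candidate C b n i))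
    (hi : n i ≤ m i - d i) (hrem : AlgRem (candidateReducers C b n i) (candidate C b n i) g)
    (hrk : rk g = rk (candidate C b n i)) :
    Invariant C y d m (extend b n i g) (n + Pi.single i 1) := by
  have hB' : IsStaircase C d m (extend b n i g) (n + Pi.single i 1) :=
    hV.extend_of_rk_eq hi (hrk.trans (hV.rk_candidate hI i)) fun t hti =>
      hV.reduced_of_algRem hI hti hmin hrem
  have hB := Set.subset_union_left (s := staircase b n) (t := {g})
  refine ⟨hB', ?_, ?_, ?_, ?_, ?_, ?_⟩
  · intro t j hj v hv
    rcases lt_add_single_iff.mp hj with hj | ⟨rfl, rfl⟩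
    · rw [extend_of_lt hj]
      exact (hV.ordLE_of_notMem t j hj v hv).mono
        (Nat.add_le_add_left (sum_sub_one_le_add_single n i) _)
    · rw [extend_self]
      exact hV.ordLE_of_algRem hI hrem hv
  all_goals rw [staircase_extend]
  · exact Set.union_subset (hV.staircase_subset_diffIdeal_lowest.trans
      (diffIdeal_mono (hV.lowest_subset_extend hI hB')))
      (Set.singleton_subset_iff.mpr (hV.mem_diffIdeal_lowest_of_algRem hI hrem hB'))
  · exact Set.union_subset hV.staircase_subset_diffIdeal
      (Set.singleton_subset_iff.mpr (hV.mem_diffIdeal_of_algRem hI hrem))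
  · rw [initSep_union]
    exact Set.union_subset hV.initSep_subset (hV.initSep_subset_of_algRem hI hrem hrk)
  · intro t ht
    rcases lt_add_single_iff.mp ht with ht | ⟨rfl, hn⟩
    · exact saturation_mono (diffIdeal_mono hB) (initSep_mono hB) (hV.mem_saturation t ht)
    · exact hV.mem_saturation_of_algRem hI hn.symm hrem
  · intro t ht
    rcases lt_add_single_iff.mp ht with ht | ⟨rfl, hn⟩
    · exact (hV.initSep_subset_saturation t ht).trans (saturation_mono
        (powersMod_mono (initSep_mono hB) (diffIdeal_mono hB)) (initSep_mono hB))
    · exact hV.initSep_subset_saturation_of_algRem hI hn.symm hrem hrk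

end Invariant

end update

section correctness

variable {Y K : Type*} [Field K] [LinearOrder (Deriv Y)] [Differential K] {k : ℕ}

/-- The output `out` is triangular and has the properties listed in the proposition, or it is `{1}`
and `[C] : H_C^∞` is the unit ideal. -/
def IsCorrectOutput (C : Fin k → DiffPoly Y K) (y : Fin k → Y) (d m : Fin k → ℕ)
    (out : Set (DiffPoly Y K)) : Prop :=
  (∃ B : Fin k → ℕ → DiffPoly Y K,
    out = {b | ∃ i j, j ≤ m i - d i ∧ b = B i j} ∧
    Triangular out ∧
    (∀ i j, j ≤ m i - d i →
      rk (B i j) = rk (δ^[j] (C i)) ∧ ∀ t, t ≠ i → Reduced (B i j) (C t)) ∧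
    (∀ i, maxOrd (y i) out ≤ m i) ∧
    (∀ v, v ∉ Set.range y → maxOrd v out ≤ maxOrd v (Set.range C) + ∑ i, (m i - d i)) ∧
    out ⊆ diffIdeal (lowest out) ∧
    diffIdeal (lowest out) ≤ diffIdeal (Set.range C) ∧
    (diffIdeal (Set.range C) : Set (DiffPoly Y K)) ⊆ saturation (diffIdeal out) (initSep out) ∧
    initSep out ⊆ powers (initSep (Set.range C)) + (diffIdeal (Set.range C) : Set _) ∧
    initSep (Set.range C) ⊆
      saturation (powers (initSep out) + (diffIdeal out : Set _)) (initSep out)) ∨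
  (out = {1} ∧ saturation (diffIdeal (Set.range C)) (initSep (Set.range C)) = Set.univ)

/-- The invariant of a state that is reached after `N` iterations. -/
def StateInvariant (C : Fin k → DiffPoly Y K) (y : Fin k → Y) (d m : Fin k → ℕ) (N : ℕ) :
    State Y K → Prop
  | .loop D B => ∃ b n, Invariant C y d m b n ∧ D = pending C n ∧ B = staircase b n ∧ ∑ i, n i = N
  | .halted out => N ≤ ∑ i, (m i - d i + 1) ∧ out = {1} ∧
      saturation (diffIdeal (Set.range C)) (initSep (Set.range C)) = Set.univ

variable {C : Fin k → DiffPoly Y K} {y : Fin k → Y} {d m : Fin k → ℕ}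
  {b : Fin k → ℕ → DiffPoly Y K} {n : Fin k → ℕ} {N : ℕ} {s s' : State Y K}

theorem StateInvariant.le (h : StateInvariant C y d m N s) : N ≤ ∑ i, (m i - d i + 1) := by
  cases s with
  | loop D B =>
    obtain ⟨b, n, hV, -, -, rfl⟩ := h
    exact Finset.sum_le_sum fun i _ => hV.le i
  | halted out => exact h.1

theorem stateInvariant_zero (C : Fin k → DiffPoly Y K) (y : Fin k → Y) (d m : Fin k → ℕ) :
    StateInvariant C y d m 0 (.loop (Set.range C) ∅) := by
  refine ⟨0, 0, invariant_zero C y d m 0, ?_, ?_, Finset.sum_const_zero⟩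
  · ext f
    exact ⟨fun ⟨i, hi⟩ => ⟨i, rfl, hi.symm⟩, fun ⟨i, _, hi⟩ => ⟨i, hi.symm⟩⟩
  · exact (staircase_zero 0).symm

variable [CharZero K]

theorem IsStaircase.triangular (hI : IsInput C y d m) (hB : IsStaircase C d m b n) :
    Triangular (staircase b n) := by
  constructor
  · rintro _ ⟨i, j, hj, rfl⟩
    rw [hB.ld_eq hI hj]
    exact WithBot.coe_ne_bot
  · rintro _ ⟨i, j, hj, rfl⟩ _ ⟨t, l, hl, rfl⟩ heq
    rw [hB.ld_eq hI hj, hB.ld_eq hI hl, hI.mk_inj] at heq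
    obtain ⟨rfl, hjl⟩ := heq
    rw [Nat.add_left_cancel hjl]

theorem Invariant.isCorrectOutput (hI : IsInput C y d m) (hV : Invariant C y d m b n)
    (hn : ∀ i, n i = m i - d i + 1) : IsCorrectOutput C y d m (staircase b n) := by
  have hlt : ∀ {i j}, j < n i ↔ j ≤ m i - d i := fun {i j} => by rw [hn i, Nat.lt_succ_iff]
  have hpos : ∀ i, 0 < n i := fun i => hlt.mpr (Nat.zero_le _)
  have hordLE : ∀ v, v ∉ Set.range y → ∀ f ∈ staircase b n,
      OrdLE v (maxOrd v (Set.range C) + ∑ i, (m i - d i)) f := by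
    rintro v hv _ ⟨i, j, hj, rfl⟩
    simpa only [hn, Nat.add_sub_cancel] using hV.ordLE_of_notMem i j hj v hv
  refine Or.inl ⟨b, ?_, hV.triangular hI,
    fun i j hj => ⟨hV.rk_eq i j (hlt.mpr hj), hV.reduced i j (hlt.mpr hj)⟩, fun t => maxOrd_le ?_,
    fun v hv => maxOrd_le (hordLE v hv), hV.staircase_subset_diffIdeal_lowest,
    hV.diffIdeal_lowest_le, diffIdeal_subset_saturation ?_, ?_, ?_⟩
  · simp only [staircase, hlt]
  · rintro _ ⟨i, j, hj, rfl⟩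
    exact hV.ordLE hI hj t
  · rintro _ ⟨i, rfl⟩
    exact hV.mem_saturation i (hpos i)
  · rw [← coe_powersMod]
    exact hV.initSep_subset
  · rw [← coe_powersMod]
    rintro _ (⟨_, ⟨i, rfl⟩, rfl⟩ | ⟨_, ⟨i, rfl⟩, rfl⟩)
    exacts [hV.initSep_subset_saturation i (hpos i) (initial_mem_initSep rfl),
      hV.initSep_subset_saturation i (hpos i) (separant_mem_initSep rfl)]

theorem StateInvariant.of_iteration (hI : IsInput C y d m) (h : StateInvariant C y d m N s)
    (hs : Iteration y m s s') : StateInvariant C y d m (N + 1) s' := by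
  cases hs with
  | update D B f g hmin hrem hrk =>
    obtain ⟨b, n, hV, rfl, rfl, rfl⟩ := h
    obtain ⟨i, hi, rfl⟩ := (hV.candidates_eq hI).subset hmin.1
    refine ⟨_, _, hV.extend_of_algRem hI hmin hi hrem hrk,
      (hI.pending_add_single hV.toIsStaircase).symm, staircase_extend.symm, ?_⟩
    simp [Finset.sum_add_distrib]
  | abort D B f g hmin hrem hrk =>
    obtain ⟨b, n, hV, rfl, rfl, rfl⟩ := h
    obtain ⟨i, hi, rfl⟩ := (hV.candidates_eq hI).subset hmin.1
    refine ⟨?_, rfl, hV.saturation_eq_univ_of_rk_ne hI hrem hrk⟩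
    exact Finset.sum_lt_sum (fun t _ => hV.le t) ⟨i, Finset.mem_univ i, Nat.lt_succ_of_le hi⟩

theorem IsInput.exists_stateInvariant (hI : IsInput C y d m)
    (h : Reachable y m (Set.range C) s) : ∃ N, StateInvariant C y d m N s := by
  induction h with
  | refl => exact ⟨0, stateInvariant_zero C y d m⟩
  | tail _ hstep ih =>
    obtain ⟨N, hN⟩ := ih
    exact ⟨N + 1, hN.of_iteration hI hstep⟩

theorem IsInput.iterations_le (hI : IsInput C y d m) {s : ℕ → State Y K}
    (h0 : s 0 = .loop (Set.range C) ∅) (hs : ∀ j < N, Iteration y m (s j) (s (j + 1))) :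
    N ≤ ∑ i, (m i - d i + 1) := by
  have hinv : ∀ j ≤ N, StateInvariant C y d m j (s j) := by
    intro j
    induction j with
    | zero => exact fun _ => h0 ▸ stateInvariant_zero C y d m
    | succ j ih => exact fun hj => (ih (Nat.le_of_succ_le hj)).of_iteration hI (hs j hj)
  exact (hinv N le_rfl).le

theorem IsInput.finite_of_reachable (hI : IsInput C y d m) {D B : Set (DiffPoly Y K)}
    (h : Reachable y m (Set.range C) (.loop D B)) : D.Finite ∧ B.Finite := by
  obtain ⟨N, b, n, -, rfl, rfl, -⟩ := hI.exists_stateInvariant h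
  exact ⟨finite_pending C n, finite_staircase b n⟩

theorem IsInput.exists_returns_or_exists_iteration (hI : IsInput C y d m)
    (h : Reachable y m (Set.range C) s) :
    (∃ out, Returns y m s out) ∨ ∃ s', Iteration y m s s' := by
  cases s with
  | halted out => exact Or.inl ⟨out, .halted out⟩
  | loop D B =>
    obtain ⟨hD, hB⟩ := hI.finite_of_reachable h
    rcases (candidates y m D B).eq_empty_or_nonempty with hempty | hne
    · exact Or.inl ⟨B, .exit D B hempty⟩
    · obtain ⟨f, hf, hmin⟩ := Set.exists_min_image _ rk (finite_candidates hD hB) hne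
      obtain ⟨g, hg⟩ := exists_algRem (finite_reducers D hB f) f
      by_cases hrk : rk g = rk f
      · exact Or.inr ⟨_, .update D B f g ⟨hf, hmin⟩ hg hrk⟩
      · exact Or.inr ⟨_, .abort D B f g ⟨hf, hmin⟩ hg hrk⟩

theorem IsInput.isCorrectOutput_of_returns (hI : IsInput C y d m) {out : Set (DiffPoly Y K)}
    (h : Reachable y m (Set.range C) s) (hout : Returns y m s out) :
    IsCorrectOutput C y d m out := by
  obtain ⟨N, hN⟩ := hI.exists_stateInvariant h
  cases hout with
  | halted out => exact Or.inr hN.2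
  | exit D B hempty =>
    obtain ⟨b, n, hV, rfl, rfl, -⟩ := hN
    refine hV.isCorrectOutput hI fun i => (hV.le i).antisymm ?_
    by_contra! hlt
    rw [hV.candidates_eq hI] at hempty
    exact Set.notMem_empty _ (hempty.subset ⟨i, Nat.le_of_lt_succ hlt, rfl⟩)

end correctness

end

end DiffAlg

open DiffAlg in
theorem mainTheorem4_general {Y K : Type*} [Field K] [CharZero K] [Differential K]
    [LinearOrder (Deriv Y)] (hR : IsRanking Y) {k : ℕ} (C : Fin k → DiffPoly Y K) (y : Fin k → Y)
    (d m : Fin k → ℕ) (hCinj : Function.Injective C) (hC : WeakDTriangular (Set.range C))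
    (hld : ∀ i, ld (C i) = (⟨y i, d i⟩ : Deriv Y))
    (hm : ∀ i, maxOrd (y i) (Set.range C) ≤ m i) :
    (∀ (N : ℕ) (s : ℕ → State Y K), s 0 = .loop (Set.range C) ∅ →
      (∀ j < N, Iteration y m (s j) (s (j + 1))) → N ≤ ∑ i, (m i - d i + 1)) ∧
    (∀ D B f, Reachable y m (Set.range C) (.loop D B) → AlgRemTerminates (reducers D B f) f) ∧
    (∀ s, Reachable y m (Set.range C) s →
      (∃ out, Returns y m s out) ∨ ∃ s', Iteration y m s s') ∧
    (∀ s out, Reachable y m (Set.range C) s → Returns y m s out →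
      IsCorrectOutput C y d m out) := by
  have hI : IsInput C y d m := ⟨hR, hld, hC.injective_of_ld_eq hCinj hld, fun i t =>
    (ordLE_maxOrd (Set.finite_range C) (Set.mem_range_self i) (y t)).mono (hm t)⟩
  exact ⟨fun _ _ h0 hs => hI.iterations_le h0 hs,
    fun D _ f h => algRemTerminates_of_finite (finite_reducers D (hI.finite_of_reachable h).2 f) f,
    fun _ h => hI.exists_returns_or_exists_iteration h,
    fun _ _ h hout => hI.isCorrectOutput_of_returns h hout⟩

open DiffAlg in
theorem mainTheorem4 {Y K : Type*} [Finite Y] [Field K] [CharZero K] [Differential K]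
    [LinearOrder (Deriv Y)] (hR : IsRanking Y)
    {k : ℕ} (C : Fin k → DiffPoly Y K) (y : Fin k → Y) (d m : Fin k → ℕ)
    (hCinj : Function.Injective C)
    (hC : WeakDTriangular (Set.range C))
    (hld : ∀ i, ld (C i) = (⟨y i, d i⟩ : Deriv Y))
    (hm : ∀ i, maxOrd (y i) (Set.range C) ≤ m i) :
    -- termination: the loop runs at most `∑ (m_i - d_i + 1)` times
    (∀ (N : ℕ) (s : ℕ → State Y K), s 0 = .loop (Set.range C) ∅ →
      (∀ j < N, Iteration y m (s j) (s (j + 1))) → N ≤ ∑ i, (m i - d i + 1)) ∧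
    -- termination: every call of `algrem` terminates
    (∀ D B f, Reachable y m (Set.range C) (.loop D B) → IsMinRank (candidates y m D B) f →
      AlgRemTerminates (reducers D B f) f) ∧
    -- the algorithm never gets stuck without an output
    (∀ s, Reachable y m (Set.range C) s →
      (∃ out, Returns y m s out) ∨ ∃ s', Iteration y m s s') ∧
    -- correctness of every output
    (∀ s out, Reachable y m (Set.range C) s → Returns y m s out →
      (∃ B : Fin k → ℕ → DiffPoly Y K,
        out = {b | ∃ i j, j ≤ m i - d i ∧ b = B i j} ∧
        Triangular out ∧
        (∀ i j, j ≤ m i - d i →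
          rk (B i j) = rk (δ^[j] (C i)) ∧ ∀ t, t ≠ i → Reduced (B i j) (C t)) ∧
        (∀ i, maxOrd (y i) out ≤ m i) ∧
        (∀ v, v ∉ Set.range y →
          maxOrd v out ≤ maxOrd v (Set.range C) + ∑ i, (m i - d i)) ∧
        out ⊆ diffIdeal (lowest out) ∧
        diffIdeal (lowest out) ≤ diffIdeal (Set.range C) ∧
        (diffIdeal (Set.range C) : Set (DiffPoly Y K)) ⊆
          saturation (diffIdeal out) (initSep out) ∧
        initSep out ⊆ powers (initSep (Set.range C)) + (diffIdeal (Set.range C) : Set _) ∧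
        initSep (Set.range C) ⊆
          saturation (powers (initSep out) + (diffIdeal out : Set _)) (initSep out)) ∨
      (out = {1} ∧
        saturation (diffIdeal (Set.range C)) (initSep (Set.range C)) = Set.univ)) := by
  obtain ⟨hiter, halg, hprogress, hout⟩ := mainTheorem4_general hR C y d m hCinj hC hld hm
  exact ⟨hiter, fun D B f h _ => halg D B f h, hprogress, hout⟩
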